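/- Let $X$ be a finite alphabet with $|X|\ge 2$ and let $S$ be a finite invertible (transducer) automaton over $X$, i.e. every state $s\in S$ and letter $x\in X$ determine a next state $s|_x$ and an output letter $s(x)$, with $x\mapsto s(x)$ a permutation of $X$. Each state acts on finite words and on $X^\omega$ by $s(xw)=s(x)\,s|_x(w)$, and $s|_v$ denotes the state reached from $s$ after reading the finite word $v$. A state is trivial, written $1$, if it acts as the identity. Assume that 1. different states define different transformations, and $S$ is bounded: the number of directed paths of length $n$ in $S\setminus\{1\}$ is bounded independently of $n$; 2. for every $n\ge 0$ the tile graph $T_n$ is connected, where $T_n$ has vertex set $X^n$, and $v,u$ are adjacent if $s(v)=u$ and $s|_v=1$ (or $s(u)=v$ and $s|_u=1$) for some $s\in S$; 3. every state of $S$ has an incoming arrow, and the set of transformations defined by $S$ is closed under inversion. Let $G$ be the group generated by $S$. For $w\in X^\omega$ the orbital Schreier graph $\Gamma_w$ has as vertices the $G$-orbit of $w$, with $v,u$ adjacent if $s(v)=u$ or $s(u)=v$ for some $s\in S$. The orbital tile graph $T_w$ is the connected component of $w$ in the subgraph of $\Gamma_w$ formed by the edges $\{v,s(v)\}$, $s\in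 S$, for which $s|_{v'}=1$ for some finite beginning $v'$ of $v$. Ends of graphs are equivalence classes of rays, and "almost all" refers to the uniform Bernoulli measure on $X^\omega$. The post-critical set $\mathcal P$ is the set of left-infinite sequences $\ldots x_2x_1$ that are the input labels of left-infinite directed paths in $S\setminus\{1\}$. The augmented model graph $\overline M$ is the simple graph with vertex set $\mathcal P\times X$ in which two distinct vertices $(p,x)$ and $(q,y)$ are adjacent if $x=y$, or if there is a left-infinite path in $S$ ending in the trivial state and labeled by $px|qy$ or by $qy|px$. A vertex $(p,x)$ of $\overline M$ is post-critical if $px\in\mathcal P$. Then: (a) almost all Schreier graphs $\Gamma_w$ have exactly two ends if and only if almost all tile graphs $T_w$ have exactly two ends; (b) if almost all Schreier graphs $\Gamma_w$ have exactly two ends, then $|\mathcal P|=2$, and $\overline M$ is an interval (isomorphic to a finite path with at least two vertices) whose two end vertices are exactly its post-critical vertices; (c) if $|\mathcal P|\ge 3$, then for almost all $w\in X^\omega$ both $\Gamma_w$ and $T_w$ have exactly one end. -/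

import Mathlib

open MeasureTheory

/-! ### Ends of a graph, as equivalence classes of rays -/

namespace SimpleGraph

variable {V : Type*}

/-- A ray: an infinite sequence of consecutively adjacent, pairwise distinct vertices. -/
structure Ray (G : SimpleGraph V) where
  toFun : ℕ → V
  adj : ∀ n, G.Adj (toFun n) (toFun (n + 1))
  injective : Function.Injective toFun

/-- Two rays are equivalent if for every finite set `F` of vertices, infinitely many vertices of
both rays belong to the same connected component of the graph with `F` removed. -/
def RayEquiv (G : SimpleGraph V) (r r' : G.Ray) : Prop :=
  ∀ F : Finset V, ∃ C : G.ComponentCompl (F : Set V),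
    {n | r.toFun n ∈ C}.Infinite ∧ {n | r'.toFun n ∈ C}.Infinite

/-- Outside a finite set of vertices, a ray eventually stays in one component. -/
theorem Ray.eventually_mem {G : SimpleGraph V} (r : G.Ray) (F : Finset V) :
    ∃ C : G.ComponentCompl (F : Set V), ∃ N, ∀ n, N ≤ n → r.toFun n ∈ C := by
  have hfin : {n | r.toFun n ∈ F}.Finite :=
    F.finite_toSet.preimage r.injective.injOn
  obtain ⟨N, hN⟩ := hfin.bddAbove
  have hout : ∀ n, N + 1 ≤ n → r.toFun n ∉ (F : Set V) := by
    intro n hn h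
    have := hN (show n ∈ {n | r.toFun n ∈ F} from h)
    omega
  refine ⟨G.componentComplMk (hout (N + 1) le_rfl), N + 1, ?_⟩
  intro n hn
  induction n, hn using Nat.le_induction with
  | base => exact G.componentComplMk_mem _
  | succ n hn ih => exact ComponentCompl.mem_of_adj _ _ ih (hout _ (by omega)) (r.adj n)

/-- A component met infinitely often by a ray contains a tail of it. -/
theorem Ray.mem_of_infinite {G : SimpleGraph V} (r : G.Ray) {F : Finset V}
    {C D : G.ComponentCompl (F : Set V)} {N : ℕ} (hC : ∀ n, N ≤ n → r.toFun n ∈ C)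
    (hD : {n | r.toFun n ∈ D}.Infinite) : D = C := by
  obtain ⟨n, hn, hNn⟩ := hD.exists_gt N
  obtain ⟨h1, h2⟩ := hC n hNn.le
  obtain ⟨h3, h4⟩ := hn
  exact h4.symm.trans h2

/-- Equivalence of rays is an equivalence relation. -/
instance raySetoid (G : SimpleGraph V) : Setoid G.Ray where
  r := G.RayEquiv
  iseqv :=
    { refl := by
        intro r F
        obtain ⟨C, N, h⟩ := r.eventually_mem F
        have hi : {n | r.toFun n ∈ C}.Infinite := (Set.Ici_infinite N).mono h
        exact ⟨C, hi, hi⟩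
      symm := by
        intro r r' h F
        obtain ⟨C, h1, h2⟩ := h F
        exact ⟨C, h2, h1⟩
      trans := by
        intro r r' r'' h h' F
        obtain ⟨C, h1, h2⟩ := h F
        obtain ⟨D, h3, h4⟩ := h' F
        obtain ⟨E, N, hE⟩ := r'.eventually_mem F
        have e1 := r'.mem_of_infinite hE h2
        have e2 := r'.mem_of_infinite hE h3
        subst e1
        subst e2
        exact ⟨_, h1, h4⟩ }

/-- The ends of a graph: equivalence classes of rays. -/
def RayEnds (G : SimpleGraph V) : Type _ := Quotient G.raySetoid

/-- The number of ends of a graph. -/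
noncomputable def numEnds (G : SimpleGraph V) : ℕ∞ := ENat.card G.RayEnds

end SimpleGraph

/-- The uniform Bernoulli measure on right-infinite sequences over a finite alphabet. -/
noncomputable def uniformBernoulli (X : Type*) [Fintype X] [Nonempty X] [MeasurableSpace X] :
    Measure (ℕ → X) :=
  Measure.infinitePi fun _ : ℕ => (PMF.uniformOfFintype X).toMeasure

instance (X : Type*) [Fintype X] [Nonempty X] [MeasurableSpace X] :
    IsProbabilityMeasure (uniformBernoulli X) := by
  unfold uniformBernoulli
  infer_instance

/-! ### Invertible automata and their actions -/

/-- An invertible transducer with states `S` over the alphabet `X`. -/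
structure InvertibleAutomaton (S X : Type*) where
  /-- transition map -/
  next : S → X → S
  /-- output map, a permutation of the alphabet at each state -/
  out : S → Equiv.Perm X

namespace InvertibleAutomaton

variable {S X : Type*} (A : InvertibleAutomaton S X)

/-- The state `s|_v` reached from `s` after reading the finite word `v`. -/
def restrict (s : S) (v : List X) : S := v.foldl A.next s

/-- The action of a state on finite words. -/
def actWord : S → List X → List X
  | _, [] => []
  | s, x :: v => A.out s x :: actWord (A.next s x) v

/-- The prefix `w_n` of length `n` of an infinite word. -/
def pre (w : ℕ → X) (n : ℕ) : List X := (List.range n).map w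

/-- The action of a state on right-infinite words. -/
def act (s : S) (w : ℕ → X) : ℕ → X := fun n => A.out (A.restrict s (pre w n)) (w n)

/-- The inverse automaton, with the roles of input and output exchanged. -/
def inverse : InvertibleAutomaton S X where
  next s y := A.next s ((A.out s).symm y)
  out s := (A.out s).symm

theorem restrict_pre_succ (s : S) (w : ℕ → X) (n : ℕ) :
    A.restrict s (pre w (n + 1)) = A.next (A.restrict s (pre w n)) (w n) := by
  simp [restrict, pre, List.range_succ]

theorem inverse_restrict (s : S) (w : ℕ → X) (n : ℕ) :
    A.inverse.restrict s (pre (A.act s w) n) = A.restrict s (pre w n) := by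
  induction n with
  | zero => rfl
  | succ n ih =>
    rw [restrict_pre_succ, restrict_pre_succ, ih]
    simp [inverse, act]

theorem inverse_act_act (s : S) (w : ℕ → X) : A.inverse.act s (A.act s w) = w := by
  funext n
  show A.inverse.out (A.inverse.restrict s (pre (A.act s w) n)) (A.act s w n) = w n
  rw [inverse_restrict]
  simp [inverse, act]

theorem inverse_inverse : A.inverse.inverse = A := by
  cases A
  simp [inverse]

/-- The transformation of the space of right-infinite words defined by a state. -/
def actPerm (s : S) : Equiv.Perm (ℕ → X) where
  toFun := A.act s
  invFun := A.inverse.act s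
  left_inv := A.inverse_act_act s
  right_inv w := by
    have h := A.inverse.inverse_act_act s w
    rwa [inverse_inverse] at h

/-- `s` is the trivial state: it defines the identity transformation. -/
def IsTrivial (s : S) : Prop := ∀ w, A.act s w = w

/-- Different states define different transformations. -/
def IsMinimal : Prop := Function.Injective A.act

/-- Paths of length `n` in the graph of the automaton with the trivial state removed: they visit
the states `p.1 0, …, p.1 n` along arrows whose input letters are `p.2 0, …, p.2 (n - 1)`. -/
def nontrivialPaths (n : ℕ) : Set ((Fin (n + 1) → S) × (Fin n → X)) :=
  {p | (∀ i, ¬ A.IsTrivial (p.1 i)) ∧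
    ∀ i : Fin n, A.next (p.1 i.castSucc) (p.2 i) = p.1 i.succ}

/-- Bounded automata: the number of paths of length `n` avoiding the trivial state is bounded
independently of `n`. -/
def IsBounded : Prop := ∃ C : ℕ, ∀ n, (A.nontrivialPaths n).encard ≤ C

/-- The set of transformations defined by the states is closed under taking inverses. -/
def IsSymmetric : Prop := ∀ s, ∃ t, A.actPerm t = (A.actPerm s)⁻¹

/-- Every state has an incoming arrow. -/
def HasIncomingArrows : Prop := ∀ s, ∃ t x, A.next t x = s

/-- The automaton group `G(S)`. -/
def group : Subgroup (Equiv.Perm (ℕ → X)) := Subgroup.closure (Set.range A.actPerm)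

/-! ### Schreier graphs and tile graphs -/

/-- The orbital Schreier graph `Γ_w`, on the orbit of `w`. -/
def schreierGraph (w : ℕ → X) : SimpleGraph (MulAction.orbit A.group w) :=
  SimpleGraph.fromRel fun v u => ∃ s, A.act s v.1 = u.1

/-- The tile graph `T_n` on the words of length `n`. -/
def tileGraph (n : ℕ) : SimpleGraph {v : List X // v.length = n} :=
  SimpleGraph.fromRel fun v u => ∃ s, A.actWord s v.1 = u.1 ∧ A.IsTrivial (A.restrict s v.1)

/-- The graph on the orbit of `w` whose edges join `v` to `s(v)` when the restriction of `s` to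
some finite beginning of `v` is trivial. -/
def tileGraphOnOrbit (w : ℕ → X) : SimpleGraph (MulAction.orbit A.group w) :=
  SimpleGraph.fromRel fun v u =>
    ∃ s, A.act s v.1 = u.1 ∧ ∃ n, A.IsTrivial (A.restrict s (pre v.1 n))

/-- The connected component of `w` in the previous graph. -/
def tileComponent (w : ℕ → X) : (A.tileGraphOnOrbit w).ConnectedComponent :=
  (A.tileGraphOnOrbit w).connectedComponentMk ⟨w, MulAction.mem_orbit_self w⟩

/-- The orbital tile graph `T_w`. -/
def orbitalTileGraph (w : ℕ → X) : SimpleGraph (A.tileComponent w) :=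
  (A.tileComponent w).toSimpleGraph

/-! ### The post-critical set and the model graph

A left-infinite sequence `… x₂ x₁` is encoded as `p : ℕ → X` with `p i = x_{i+1}`, so that `p 0` is
its last letter. A left-infinite path `… e₂ e₁` is encoded by its states `t : ℕ → S`: the arrow
`e_{i+1}` goes from `t (i + 1)` to `t i`, and the path ends in `t 0`. -/

/-- There is an arrow from `s` to `t` labeled `x|y`. -/
def Arrow (s : S) (x y : X) (t : S) : Prop := A.next s x = t ∧ A.out s x = y

/-- The post-critical set: sequences read along left-infinite paths avoiding the trivial state. -/
def postCriticalSet : Set (ℕ → X) :=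
  {p | ∃ t : ℕ → S, (∀ i, ¬ A.IsTrivial (t i)) ∧
    ∃ q : ℕ → X, ∀ i, A.Arrow (t (i + 1)) (p i) (q i) (t i)}

/-- The left-infinite sequence `px`, obtained by appending the letter `x` to `p`. -/
def snoc (p : ℕ → X) (x : X) : ℕ → X
  | 0 => x
  | i + 1 => p i

/-- The edge relation of the model graph: there is a left-infinite path ending in the trivial
state and labeled by `px|qy`. -/
def ModelEdge (a b : A.postCriticalSet × X) : Prop :=
  ∃ t : ℕ → S, A.IsTrivial (t 0) ∧
    ∀ i, A.Arrow (t (i + 1)) (snoc a.1.1 a.2 i) (snoc b.1.1 b.2 i) (t i)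

/-- The model graph `M`. -/
def modelGraph : SimpleGraph (A.postCriticalSet × X) := SimpleGraph.fromRel A.ModelEdge

/-- The augmented model graph: for every letter `x`, all vertices `(p, x)` are joined. -/
def augmentedModelGraph : SimpleGraph (A.postCriticalSet × X) :=
  A.modelGraph ⊔ SimpleGraph.fromRel fun a b => a.2 = b.2

/-- A vertex `(p, x)` of the model graph is post-critical if the sequence `px` is. -/
def IsPostCriticalVertex (a : A.postCriticalSet × X) : Prop :=
  snoc a.1.1 a.2 ∈ A.postCriticalSet

end InvertibleAutomaton

/-! The proof is a dichotomy on `HasEnclosedTile`: does some level contain a vertex `u`, not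
post-critical, whose removal leaves all post-critical vertices of that tile graph in one component?

If so, almost every `w` contains `u` at infinitely many positions (`ae_frequently_eq_block`) and is
regular, meaning that every state becomes trivial along every sequence of its orbit; boundedness
leaves only countably many exceptions. A finite set of vertices then lies in a small tile with
address `u` inside a larger tile. Walks from outside enter the larger tile through post-critical
vertices, and these are joined to each other around the small tile. So there is one end
(`IsRegularSeq.numEnds_eq_one`).

If not, every non-post-critical vertex of a tile graph separates two post-critical ones, so all
leaves of a spanning tree are post-critical and its branching vertices are bounded in number
(`IsTree.card_branch_add_two_le`). A vertex with three neighbours would be copied into exponentially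
many disjoint stars at higher levels, so tile graphs have degree at most two. A post-critical vertex
acquires a further neighbour at a higher level, hence has degree at most one. Counting degrees
leaves exactly two post-critical words per level, so two post-critical sequences. Comparison with
`T_2` carries the degree bounds over to the augmented model graph, making it a path.

Two ends almost surely exclude the first case, and three post-critical sequences exclude the second.
For regular `w` the tile graph and the Schreier graph have the same edges, which gives (a) and the
tile graph half of (c). -/

namespace SimpleGraph

/-! ### Ends through walks avoiding finite sets -/

section Ends

variable {V W : Type*}

/-- `b` can be reached from `a` by a walk of `G` all of whose edges avoid the set `F`. -/
def AvoidReach (G : SimpleGraph V) (F : Set V) : V → V → Prop :=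
  Relation.ReflTransGen fun x y => G.Adj x y ∧ x ∉ F ∧ y ∉ F

theorem AvoidReach.symm {G : SimpleGraph V} {F : Set V} {a b : V} (h : G.AvoidReach F a b) :
    G.AvoidReach F b a := by
  induction h with
  | refl => exact .refl
  | tail _ h ih => exact .head ⟨h.1.symm, h.2.2, h.2.1⟩ ih

theorem AvoidReach.mono {G H : SimpleGraph V} {F F' : Set V} (hG : G ≤ H) (hF : F' ⊆ F) {a b : V}
    (h : G.AvoidReach F a b) : H.AvoidReach F' a b := by
  induction h with
  | refl => exact .refl
  | tail _ h ih => exact .tail ih ⟨hG h.1, fun h' => h.2.1 (hF h'), fun h' => h.2.2 (hF h')⟩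

theorem AvoidReach.map {G : SimpleGraph V} {H : SimpleGraph W} {F : Set V} {F' : Set W}
    (f : V → W) (hf : ∀ x y, G.Adj x y → x ∉ F → y ∉ F → H.AvoidReach F' (f x) (f y)) {a b : V}
    (h : G.AvoidReach F a b) : H.AvoidReach F' (f a) (f b) := by
  induction h with
  | refl => exact .refl
  | tail _ h ih => exact ih.trans (hf _ _ h.1 h.2.1 h.2.2)

theorem AvoidReach.single {G : SimpleGraph V} {F : Set V} {a b : V} (h : G.Adj a b) (ha : a ∉ F)
    (hb : b ∉ F) : G.AvoidReach F a b :=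
  Relation.ReflTransGen.single ⟨h, ha, hb⟩

theorem componentComplMk_eq_iff {G : SimpleGraph V} {F : Set V} {a b : V} (ha : a ∉ F)
    (hb : b ∉ F) : G.componentComplMk ha = G.componentComplMk hb ↔ G.AvoidReach F a b := by
  constructor
  · intro h
    have h' : (G.induce Fᶜ).Reachable ⟨a, ha⟩ ⟨b, hb⟩ := ConnectedComponent.exact h
    obtain ⟨p⟩ := h'
    have key : ∀ x y : (Fᶜ : Set V), (G.induce Fᶜ).Walk x y → G.AvoidReach F x.1 y.1 := by
      intro x y p
      induction p with
      | nil => exact .refl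
      | @cons x y _ hadj _ ih => exact .head ⟨hadj, x.2, y.2⟩ ih
    exact key _ _ p
  · intro h
    induction h with
    | refl => rfl
    | tail _ h ih => exact (ih h.2.1).trans (G.componentComplMk_eq_of_adj _ _ h.1)

/-- A ray has a tail in a single component off `F`, so meeting a component infinitely often is the
same as ending in it. -/
theorem rayEquiv_iff {G : SimpleGraph V} (r r' : G.Ray) :
    G.RayEquiv r r' ↔
      ∀ F : Finset V, ∃ N, ∀ m n, N ≤ m → N ≤ n → G.AvoidReach F (r.toFun m) (r'.toFun n) := by
  constructor
  · intro h F
    obtain ⟨C, h1, h2⟩ := h F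
    obtain ⟨D, N, hD⟩ := r.eventually_mem F
    obtain ⟨D', N', hD'⟩ := r'.eventually_mem F
    obtain rfl := r.mem_of_infinite hD h1
    obtain rfl := r'.mem_of_infinite hD' h2
    refine ⟨max N N', fun m n hm hn => ?_⟩
    obtain ⟨hm1, hm2⟩ := hD m (le_trans (le_max_left _ _) hm)
    obtain ⟨hn1, hn2⟩ := hD' n (le_trans (le_max_right _ _) hn)
    exact (componentComplMk_eq_iff hm1 hn1).1 (hm2.trans hn2.symm)
  · intro h F
    obtain ⟨N, hN⟩ := h F
    obtain ⟨D, M, hD⟩ := r.eventually_mem F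
    obtain ⟨D', M', hD'⟩ := r'.eventually_mem F
    set K := max N (max M M') with hK
    obtain ⟨h1, h1'⟩ := hD K (by omega)
    obtain ⟨h2, h2'⟩ := hD' K (by omega)
    have : D = D' := by
      rw [← h1', ← h2']
      exact (componentComplMk_eq_iff h1 h2).2 (hN K K (by omega) (by omega))
    subst this
    exact ⟨D, (Set.Ici_infinite M).mono hD, (Set.Ici_infinite M').mono hD'⟩

/-- The image of a ray under an isomorphism. -/
def Ray.map {G : SimpleGraph V} {H : SimpleGraph W} (e : G ≃g H) (r : G.Ray) : H.Ray where
  toFun n := e (r.toFun n)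
  adj n := e.map_adj_iff.2 (r.adj n)
  injective := e.injective.comp r.injective

theorem RayEquiv.map {G : SimpleGraph V} {H : SimpleGraph W} (e : G ≃g H) {r r' : G.Ray}
    (h : G.RayEquiv r r') : H.RayEquiv (r.map e) (r'.map e) := by
  classical
  rw [rayEquiv_iff] at h ⊢
  intro F
  obtain ⟨N, hN⟩ := h (F.image e.symm)
  refine ⟨N, fun m n hm hn => (hN m n hm hn).map e ?_⟩
  intro x y h1 h2 h3
  refine .single (e.map_adj_iff.2 h1) (fun hx => h2 ?_) (fun hy => h3 ?_)
  · simpa using ⟨e x, hx, by simp⟩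
  · simpa using ⟨e y, hy, by simp⟩

theorem numEnds_congr {G : SimpleGraph V} {H : SimpleGraph W} (e : G ≃g H) :
    G.numEnds = H.numEnds := by
  refine ENat.card_congr ?_
  refine
    { toFun := Quotient.map (Ray.map e) fun _ _ h => RayEquiv.map e h
      invFun := Quotient.map (Ray.map e.symm) fun _ _ h => RayEquiv.map e.symm h
      left_inv := ?_
      right_inv := ?_ }
  · rintro ⟨r⟩
    have : (r.map e).map e.symm = r := by cases r; simp [Ray.map]
    exact congrArg (Quotient.mk _) this
  · rintro ⟨r⟩
    have : (r.map e.symm).map e = r := by cases r; simp [Ray.map]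
    exact congrArg (Quotient.mk _) this

/-- Kőnig's lemma: an infinite connected locally finite graph contains a ray. -/
theorem Connected.exists_ray {G : SimpleGraph V} [Infinite V] (hG : G.Connected)
    (hfin : ∀ v, {u | G.Adj v u}.Finite) : Nonempty G.Ray := by
  obtain ⟨o⟩ := hG.nonempty
  -- `D v` holds the vertices with a geodesic from `o` through `v`. The ray keeps `D v` infinite and
  -- moves away from `o` at each step, which makes it injective.
  let D : V → Set V := fun v => {u | G.dist o u = G.dist o v + G.dist v u}
  have step : ∀ v, (D v).Infinite →
      ∃ v', G.Adj v v' ∧ G.dist o v' = G.dist o v + 1 ∧ (D v').Infinite := by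
    intro v hv
    by_contra! hcon
    have hN : {v' | G.Adj v v' ∧ G.dist o v' = G.dist o v + 1}.Finite :=
      (hfin v).subset fun _ h => h.1
    refine hv (((hN.biUnion (t := D) fun v' hv' => ?_).union (Set.finite_singleton v)).subset ?_)
    · exact hcon v' hv'.1 hv'.2
    · intro u hu
      by_cases huv : u = v
      · exact Or.inr huv
      left
      obtain ⟨p, hp⟩ := hG.exists_walk_length_eq_dist v u
      cases p with
      | nil => exact absurd rfl huv
      | @cons _ v' _ hadj q =>
        have h1 : G.dist v' u ≤ q.length := dist_le q
        have h2 : G.dist o u ≤ G.dist o v' + G.dist v' u := hG.dist_triangle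
        have h3 : G.dist o v' ≤ G.dist o v + G.dist v v' := hG.dist_triangle
        have h4 : G.dist v v' = 1 := dist_eq_one_iff_adj.2 hadj
        have hu' : G.dist o u = G.dist o v + G.dist v u := hu
        rw [Walk.length_cons] at hp
        refine Set.mem_biUnion (x := v') ⟨hadj, by omega⟩ ?_
        show G.dist o u = G.dist o v' + G.dist v' u
        omega
  have h0 : (D o).Infinite := by
    have : D o = Set.univ := by ext u; simp [D]
    rw [this]
    exact Set.infinite_univ
  choose f hf using fun v : {v // (D v).Infinite} => step v.1 v.2
  let r : ℕ → {v // (D v).Infinite} := Nat.rec ⟨o, h0⟩ fun _ v => ⟨f v, (hf v).2.2⟩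
  have hr : ∀ n, G.dist o (r n).1 = n := by
    intro n
    induction n with
    | zero => simp [r]
    | succ n ih => exact ((hf (r n)).2.1).trans (by rw [ih])
  exact ⟨⟨fun n => (r n).1, fun n => (hf (r n)).1, fun m n h => by
    rw [← hr m, ← hr n]; exact congrArg _ h⟩⟩

/-- An infinite connected locally finite graph has one end if every finite set is avoided by
walks between any two vertices outside of some larger finite set. -/
theorem Connected.numEnds_eq_one {G : SimpleGraph V} [Infinite V] (hG : G.Connected)
    (hfin : ∀ v, {u | G.Adj v u}.Finite)
    (h : ∀ F : Finset V, ∃ F' : Finset V, ∀ a b, a ∉ F' → b ∉ F' → G.AvoidReach F a b) :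
    G.numEnds = 1 := by
  obtain ⟨r⟩ := hG.exists_ray hfin
  refine (ENat.card_eq_one_iff_unique.2 ?_)
  refine (unique_iff_subsingleton_and_nonempty _).2 ⟨⟨?_⟩, ⟨Quotient.mk _ r⟩⟩
  rintro ⟨r₁⟩ ⟨r₂⟩
  refine Quotient.sound (s := G.raySetoid) ((rayEquiv_iff r₁ r₂).2 fun F => ?_)
  obtain ⟨F', hF'⟩ := h F
  have key : ∀ r : G.Ray, ∃ N, ∀ n, N ≤ n → r.toFun n ∉ F' := by
    intro r
    obtain ⟨C, N, hN⟩ := r.eventually_mem F'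
    exact ⟨N, fun n hn => (hN n hn).1⟩
  obtain ⟨N₁, h₁⟩ := key r₁
  obtain ⟨N₂, h₂⟩ := key r₂
  exact ⟨max N₁ N₂, fun m n hm hn => hF' _ _ (h₁ m (le_trans (le_max_left _ _) hm))
    (h₂ n (le_trans (le_max_right _ _) hn))⟩

end Ends

/-! ### Branching vertices of spanning trees -/

section Trees

variable {V W : Type*}

/-- If every vertex outside of `P` separates two vertices of `P`, then a spanning tree has at most
`|P| - 2` branching vertices. -/
theorem IsTree.card_branch_add_two_le [Finite V] [Nontrivial V] {G T : SimpleGraph V}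
    (hT : T.IsTree) (hTG : T ≤ G) {P : Set V}
    (hP : ∀ v, v ∉ P → ∃ z ∈ P, ∃ z' ∈ P, ¬ G.AvoidReach {v} z z') :
    {v | ∃ a b c, T.Adj v a ∧ T.Adj v b ∧ T.Adj v c ∧ a ≠ b ∧ a ≠ c ∧ b ≠ c}.ncard + 2
      ≤ P.ncard := by
  classical
  have := Fintype.ofFinite V
  -- Deleting a leaf keeps the tree connected, so a leaf separates nothing.
  have hleaf : ∀ v, T.degree v = 1 → v ∈ P := by
    intro v hv
    by_contra hvP
    obtain ⟨z, hz, z', hz', hsep⟩ := hP v hvP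
    have hc := hT.connected.induce_compl_singleton_of_degree_eq_one hv
    have hzv : z ∉ ({v} : Set V) := by rintro rfl; exact hvP hz
    have hzv' : z' ∉ ({v} : Set V) := by rintro rfl; exact hvP hz'
    refine hsep (((componentComplMk_eq_iff hzv hzv').1 ?_).mono hTG subset_rfl)
    exact ConnectedComponent.sound (hc.preconnected _ _)
  set B : Finset V := Finset.univ.filter fun v => 3 ≤ T.degree v with hB
  set L : Finset V := Finset.univ.filter fun v => T.degree v = 1 with hL
  have hsum := T.sum_degrees_eq_twice_card_edges
  have hedge := hT.card_edgeFinset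
  have hpos : ∀ v, 1 ≤ T.degree v := fun v => hT.preconnected.degree_pos_of_nontrivial v
  -- Since the degrees of a tree sum to `2|V| - 2`, this vertexwise inequality yields `|B| + 2 ≤
  -- |L|`.
  have hineq : ∑ v : V, (2 + if v ∈ B then 1 else 0) ≤ ∑ v : V, (T.degree v + if v ∈ L then 1 else 0) := by
    refine Finset.sum_le_sum fun v _ => ?_
    have := hpos v
    simp only [hB, hL, Finset.mem_filter, Finset.mem_univ, true_and]
    split_ifs <;> omega
  simp only [Finset.sum_add_distrib, Finset.sum_const, Finset.card_univ, smul_eq_mul,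
    Finset.sum_ite_mem, Finset.univ_inter, mul_one] at hineq
  have hBL : B.card + 2 ≤ L.card := by omega
  have hLP : L.card ≤ P.ncard := by
    rw [← Set.ncard_coe_finset]
    exact Set.ncard_le_ncard (fun v hv => hleaf v (by simpa [hL] using hv)) (Set.toFinite _)
  have hBle : {v | ∃ a b c, T.Adj v a ∧ T.Adj v b ∧ T.Adj v c ∧ a ≠ b ∧ a ≠ c ∧ b ≠ c}.ncard
      ≤ B.card := by
    rw [← Set.ncard_coe_finset]
    refine Set.ncard_le_ncard ?_ (Set.toFinite _)
    rintro v ⟨a, b, c, ha, hb, hc, hab, hac, hbc⟩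
    have : ({a, b, c} : Finset V).card = 3 := Finset.card_eq_three.2 ⟨a, b, c, hab, hac, hbc, rfl⟩
    simp only [hB, Finset.coe_filter, Finset.mem_univ, true_and, Set.mem_ofPred_eq]
    rw [← this, ← card_neighborFinset_eq_degree]
    refine Finset.card_le_card fun x hx => ?_
    simp only [Finset.mem_insert, Finset.mem_singleton] at hx
    rcases hx with rfl | rfl | rfl <;> simpa
  omega

/-- A disjoint union of stars is a forest. -/
theorem isAcyclic_of_leaf {G : SimpleGraph V}
    (h : ∀ v w, G.Adj v w → (∀ x, G.Adj v x → x = w) ∨ ∀ x, G.Adj w x → x = v) :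
    G.IsAcyclic := by
  have key : ∀ v w, (∀ x, G.Adj v x → x = w) → v ≠ w →
      ¬ (G.deleteEdges {s(v, w)}).Reachable v w := by
    rintro v w hv hne ⟨p⟩
    cases p with
    | nil => exact hne rfl
    | cons hadj q =>
      rw [deleteEdges_adj] at hadj
      obtain rfl := hv _ hadj.1
      exact hadj.2 rfl
  rw [isAcyclic_iff_forall_adj_isBridge]
  intro v w hvw
  rw [isBridge_iff]
  rcases h v w hvw with h | h
  · exact key v w h hvw.ne
  · intro hr
    have := key w v h hvw.ne'
    rw [Sym2.eq_swap] at this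
    exact this hr.symm

/-- If every vertex of a connected graph `G` outside of `P` separates two vertices of `P`, then the
number of disjoint stars with three leaves in `G` is at most `|P| - 2`. -/
theorem Connected.card_stars_add_two_le [Finite V] [Nontrivial V] {G : SimpleGraph V}
    (hG : G.Connected) {P : Set V}
    (hP : ∀ v, v ∉ P → ∃ z ∈ P, ∃ z' ∈ P, ¬ G.AvoidReach {v} z z')
    (o : W → V) (f : W → Fin 3 → V) (hadj : ∀ i j, G.Adj (o i) (f i j))
    (hf : ∀ i, Function.Injective (f i)) (ho : Function.Injective o)
    (hof : ∀ i i' j, o i ≠ f i' j) (hff : ∀ i i' j j', f i j = f i' j' → i = i') :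
    Nat.card W + 2 ≤ P.ncard := by
  -- The union of the stars is a forest, so it extends to a spanning tree in which every centre
  -- still has three neighbours.
  let H : SimpleGraph V := SimpleGraph.fromRel fun x y => ∃ i j, x = o i ∧ y = f i j
  have hHadj : ∀ i j, H.Adj (o i) (f i j) := fun i j =>
    (fromRel_adj _ _ _).2 ⟨(hadj i j).ne, Or.inl ⟨i, j, rfl, rfl⟩⟩
  have hHG : H ≤ G := by
    intro x y hxy
    rcases ((fromRel_adj _ _ _).1 hxy).2 with ⟨i, j, rfl, rfl⟩ | ⟨i, j, rfl, rfl⟩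
    · exact hadj i j
    · exact (hadj i j).symm
  have hleaf : ∀ i j x, H.Adj (f i j) x → x = o i := by
    intro i j x hx
    rcases ((fromRel_adj _ _ _).1 hx).2 with ⟨i', j', h1, -⟩ | ⟨i', j', h1, h2⟩
    · exact absurd h1.symm (hof _ _ _)
    · rw [h1, hff _ _ _ _ h2]
  have hac : H.IsAcyclic := by
    refine isAcyclic_of_leaf fun v w hvw => ?_
    rcases ((fromRel_adj _ _ _).1 hvw).2 with ⟨i, j, rfl, rfl⟩ | ⟨i, j, rfl, rfl⟩
    · exact Or.inr (hleaf i j)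
    · exact Or.inl (hleaf i j)
  obtain ⟨T, hHT, hTG, hT⟩ := hG.exists_isTree_le_of_le_of_isAcyclic hHG hac
  refine le_trans (Nat.add_le_add_right ?_ 2) (hT.card_branch_add_two_le hTG hP)
  rw [← Set.ncard_univ, ← Set.ncard_image_of_injective _ ho]
  refine Set.ncard_le_ncard ?_ (Set.toFinite _)
  rintro _ ⟨i, -, rfl⟩
  exact ⟨f i 0, f i 1, f i 2, hHT (hHadj i 0), hHT (hHadj i 1), hHT (hHadj i 2),
    (hf i).ne (by decide), (hf i).ne (by decide), (hf i).ne (by decide)⟩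

end Trees

end SimpleGraph

namespace SimpleGraph

/-! ### Recognising a finite path by its degrees -/

section Path

variable {V : Type*}

theorem Connected.exists_adj_dist_eq {G : SimpleGraph V} (hG : G.Connected) {a v : V} {r : ℕ}
    (h : G.dist a v = r + 1) : ∃ v', G.Adj v v' ∧ G.dist a v' = r := by
  obtain ⟨p, hp⟩ := hG.exists_walk_length_eq_dist v a
  rw [dist_comm] at h
  cases p with
  | nil => simp at h
  | @cons _ v' _ hadj q =>
    refine ⟨v', hadj, ?_⟩
    have h1 : G.dist v' a ≤ q.length := dist_le q
    have h2 : G.dist v a ≤ G.dist v v' + G.dist v' a := hG.dist_triangle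
    have h3 : G.dist v v' = 1 := dist_eq_one_iff_adj.2 hadj
    rw [Walk.length_cons] at hp
    rw [dist_comm]
    omega

/-- A finite connected graph of maximal degree two with two vertices of degree one is a path joining
these vertices. -/
theorem Connected.exists_iso_pathGraph [Finite V] {G : SimpleGraph V} (hG : G.Connected)
    (hdeg : ∀ v x y z, G.Adj v x → G.Adj v y → G.Adj v z → x = y ∨ x = z ∨ y = z)
    {a b : V} (hab : a ≠ b) (ha : ∀ x y, G.Adj a x → G.Adj a y → x = y)
    (hb : ∀ x y, G.Adj b x → G.Adj b y → x = y) :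
    ∃ (n : ℕ) (φ : G ≃g pathGraph (n + 2)), φ a = 0 ∧ φ b = Fin.last (n + 1) := by
  -- Distance from `a` is to be the coordinate on the path. Vertices at distance `r + 1` share their
  -- predecessor by induction; two of them would give it three neighbours, or two if it is `a`.
  have inj : ∀ r v w, G.dist a v = r → G.dist a w = r → v = w := by
    intro r
    induction r with
    | zero =>
      intro v w hv hw
      rw [← hG.dist_eq_zero_iff.1 hv, ← hG.dist_eq_zero_iff.1 hw]
    | succ r ih =>
      intro v w hv hw
      obtain ⟨v', hv', hvd⟩ := hG.exists_adj_dist_eq hv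
      obtain ⟨w', hw', hwd⟩ := hG.exists_adj_dist_eq hw
      obtain rfl := ih _ _ hvd hwd
      rcases r with _ | r
      · obtain rfl := hG.dist_eq_zero_iff.1 hvd
        exact ha _ _ hv'.symm hw'.symm
      · obtain ⟨u, hu, hud⟩ := hG.exists_adj_dist_eq hvd
        rcases hdeg v' u v w hu hv'.symm hw'.symm with h | h | h
        · subst h; omega
        · subst h; omega
        · exact h
  have hne : Nonempty V := ⟨a⟩
  obtain ⟨m, hm⟩ := Finite.exists_max fun v => G.dist a v
  have hsurj : ∀ i, i ≤ G.dist a m → ∃ v, G.dist a v = i := by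
    intro i hi
    induction hi using Nat.decreasingInduction with
    | self => exact ⟨m, rfl⟩
    | of_succ i _ ih =>
      obtain ⟨v, hv⟩ := ih
      obtain ⟨v', -, hv'⟩ := hG.exists_adj_dist_eq hv
      exact ⟨v', hv'⟩
  have hbpos : 0 < G.dist a b := hG.pos_dist_of_ne hab
  have hbm := hm b
  obtain ⟨n, hn⟩ : ∃ n, G.dist a m = n + 1 := ⟨G.dist a m - 1, by omega⟩
  have hadj : ∀ v w, G.dist a w = G.dist a v + 1 → G.Adj v w := by
    intro v w h
    obtain ⟨v', hv', hd⟩ := hG.exists_adj_dist_eq h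
    obtain rfl := inj _ v' v hd rfl
    exact hv'.symm
  let e : V ≃ Fin (n + 2) := Equiv.ofBijective
    (fun v => ⟨G.dist a v, by have := hm v; omega⟩)
    ⟨fun v w h => inj _ v w rfl (Fin.mk.inj h).symm, fun i => by
      obtain ⟨v, hv⟩ := hsurj i.1 (by omega)
      exact ⟨v, Fin.ext hv⟩⟩
  have he : ∀ v, (e v).val = G.dist a v := fun v => rfl
  refine ⟨n, ⟨e, ?_⟩, ?_, ?_⟩
  · intro v w
    rw [pathGraph_adj, he, he]
    constructor
    · rintro (h | h)
      · exact hadj v w h.symm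
      · exact (hadj w v h.symm).symm
    · intro h
      have hvw : G.dist a v ≠ G.dist a w := fun h' => h.ne (inj _ v w h' rfl)
      have h1 : G.dist a w ≤ G.dist a v + G.dist v w := hG.dist_triangle
      have h2 : G.dist a v ≤ G.dist a w + G.dist w v := hG.dist_triangle
      have h3 : G.dist v w = 1 := dist_eq_one_iff_adj.2 h
      rw [dist_comm (u := w), h3] at h2
      omega
  · exact Fin.ext (by simp [he])
  · refine Fin.ext ?_
    show (e b).val = n + 1
    rw [he]
    -- If `b` were not farthest from `a`, it would have one neighbour nearer to `a` and one farther
    -- away.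
    by_contra hlt
    obtain ⟨c, hc⟩ := hsurj (G.dist a b + 1) (by omega)
    obtain ⟨d, hd, hdd⟩ := hG.exists_adj_dist_eq (a := a) (v := b) (r := G.dist a b - 1) (by omega)
    obtain rfl := hb _ _ (hadj b c hc) hd
    omega

end Path

end SimpleGraph

namespace InvertibleAutomaton

variable {S X : Type*}

/-! ### Words and sequences -/

/-- The right-infinite sequence obtained by writing a finite word before a sequence. -/
def app : List X → (ℕ → X) → ℕ → X
  | [], w => w
  | x :: v, w => snoc (app v w) x

@[simp] theorem pre_length (w : ℕ → X) (n : ℕ) : (pre w n).length = n := by simp [pre]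

theorem pre_succ (w : ℕ → X) (n : ℕ) : pre w (n + 1) = pre w n ++ [w n] := by
  simp [pre, List.range_succ]

theorem pre_snoc (w : ℕ → X) (x : X) (n : ℕ) : pre (snoc w x) (n + 1) = x :: pre w n := by
  simp only [pre, List.range_succ_eq_map, List.map_cons, List.map_map]
  rfl

theorem pre_succ' (w : ℕ → X) (n : ℕ) : pre w (n + 1) = w 0 :: pre (fun i => w (i + 1)) n := by
  rw [← pre_snoc]
  congr 1
  funext i
  cases i <;> rfl

theorem pre_eq_iff {w w' : ℕ → X} {n : ℕ} : pre w n = pre w' n ↔ ∀ i < n, w i = w' i := by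
  simp [pre]

theorem app_append (u v : List X) (w : ℕ → X) : app (u ++ v) w = app u (app v w) := by
  induction u with
  | nil => rfl
  | cons x u ih => simp [app, ih]

theorem pre_app (v : List X) (w : ℕ → X) : pre (app v w) v.length = v := by
  induction v with
  | nil => rfl
  | cons x v ih => rw [app, List.length_cons, pre_snoc, ih]

theorem app_pre (w : ℕ → X) (n : ℕ) : app (pre w n) (fun i => w (n + i)) = w := by
  induction n generalizing w with
  | zero => simp [pre, app]
  | succ n ih =>
    rw [pre_succ', app]
    have := ih fun i => w (i + 1)
    funext i
    cases i with
    | zero => rfl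
    | succ i =>
      rw [← congrFun this i]
      simp only [snoc]
      congr 2
      funext j
      congr 1
      omega

theorem app_left_cancel {u v : List X} {w w' : ℕ → X} (hl : u.length = v.length)
    (h : app u w = app v w') : u = v := by
  have h1 := pre_app u w
  rw [h, hl, pre_app] at h1
  exact h1.symm

/-- A set of sequences is not larger than all of its sets of prefixes. -/
theorem encard_le_of_pre {Z : Set (ℕ → X)} {C : ℕ}
    (h : ∀ n, 1 ≤ n → ((fun p => pre p n) '' Z).encard ≤ C) : Z.encard ≤ C := by
  by_contra! hcon
  have h1 : ((C + 1 : ℕ) : ℕ∞) ≤ Z.encard := by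
    rw [Nat.cast_add, Nat.cast_one]
    exact Order.add_one_le_of_lt hcon
  obtain ⟨Y, hYZ, hY⟩ := Set.exists_subset_encard_eq h1
  have hYfin : Y.Finite := Set.finite_of_encard_eq_coe hY
  -- Finitely many sequences are told apart by a long enough prefix: beyond the largest of the
  -- chosen positions where pairs differ.
  have hsep : ∃ n, 1 ≤ n ∧ Set.InjOn (fun p => pre p n) Y := by
    have hex : ∀ ab : (ℕ → X) × (ℕ → X), ∃ i, ab.1 = ab.2 ∨ ab.1 i ≠ ab.2 i := by
      rintro ⟨a, b⟩
      by_cases hab : a = b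
      · exact ⟨0, Or.inl hab⟩
      · obtain ⟨i, hi⟩ := Function.ne_iff.1 hab
        exact ⟨i, Or.inr hi⟩
    choose g hg using hex
    obtain ⟨N, hN⟩ := ((hYfin.prod hYfin).image g).bddAbove
    refine ⟨N + 1, by omega, fun a ha b hb hab => ?_⟩
    rcases hg (a, b) with h | h
    · exact h
    · exact absurd (pre_eq_iff.1 hab _ (Nat.lt_succ_of_le
        (hN ⟨(a, b), ⟨ha, hb⟩, rfl⟩))) h
  obtain ⟨n, hn1, hn⟩ := hsep
  have h2 := (Set.encard_le_encard (Set.image_mono hYZ)).trans (h n hn1)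
  rw [hn.encard_image, hY] at h2
  exact absurd (Nat.cast_le.1 h2) (by omega)

/-! ### Basic properties of the action -/

variable (A : InvertibleAutomaton S X)

@[simp] theorem restrict_nil (s : S) : A.restrict s [] = s := rfl

@[simp] theorem restrict_cons (s : S) (x : X) (v : List X) :
    A.restrict s (x :: v) = A.restrict (A.next s x) v := rfl

theorem restrict_append (s : S) (u v : List X) :
    A.restrict s (u ++ v) = A.restrict (A.restrict s u) v := by
  simp [restrict]

@[simp] theorem actWord_length (s : S) (v : List X) : (A.actWord s v).length = v.length := by
  induction v generalizing s with
  | nil => rfl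
  | cons x v ih => simp [actWord, ih]

theorem actWord_append (s : S) (u v : List X) :
    A.actWord s (u ++ v) = A.actWord s u ++ A.actWord (A.restrict s u) v := by
  induction u generalizing s with
  | nil => rfl
  | cons x u ih => simp [actWord, ih]

theorem act_snoc (s : S) (w : ℕ → X) (x : X) :
    A.act s (snoc w x) = snoc (A.act (A.next s x) w) (A.out s x) := by
  funext n
  cases n with
  | zero => rfl
  | succ n =>
    show A.out (A.restrict s (pre (snoc w x) (n + 1))) (w n) = A.act (A.next s x) w n
    rw [pre_snoc]
    rfl

theorem act_app (s : S) (v : List X) (w : ℕ → X) :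
    A.act s (app v w) = app (A.actWord s v) (A.act (A.restrict s v) w) := by
  induction v generalizing s with
  | nil => rfl
  | cons x v ih => simp [app, actWord, act_snoc, ih]

theorem act_surjective (s : S) : Function.Surjective (A.act s) := (A.actPerm s).surjective

variable {A}

theorem snoc_injective {w w' : ℕ → X} {x y : X} (h : snoc w x = snoc w' y) : w = w' ∧ x = y :=
  ⟨funext fun i => congrFun h (i + 1), congrFun h 0⟩

theorem IsTrivial.out_eq {s : S} (h : A.IsTrivial s) (x : X) : A.out s x = x := by
  have := h (snoc (fun _ => x) x)
  rw [act_snoc] at this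
  exact (snoc_injective this).2

theorem IsTrivial.next {s : S} (h : A.IsTrivial s) (x : X) : A.IsTrivial (A.next s x) := by
  intro w
  have := h (snoc w x)
  rw [act_snoc] at this
  exact (snoc_injective this).1

theorem IsTrivial.restrict {s : S} (h : A.IsTrivial s) (v : List X) :
    A.IsTrivial (A.restrict s v) := by
  induction v generalizing s with
  | nil => exact h
  | cons x v ih => exact ih (h.next x)

theorem IsTrivial.actWord_eq {s : S} (h : A.IsTrivial s) (v : List X) : A.actWord s v = v := by
  induction v generalizing s with
  | nil => rfl
  | cons x v ih => rw [actWord, h.out_eq, ih (h.next x)]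

theorem IsTrivial.restrict_pre_of_le {s : S} {w : ℕ → X} {m n : ℕ} (hmn : m ≤ n)
    (h : A.IsTrivial (A.restrict s (pre w m))) : A.IsTrivial (A.restrict s (pre w n)) := by
  induction n, hmn using Nat.le_induction with
  | base => exact h
  | succ n _ ih => rw [restrict_pre_succ]; exact ih.next _

/-! ### Inverse states -/

/-- The state defining the inverse transformation. -/
noncomputable def inv (hsymm : A.IsSymmetric) (s : S) : S := (hsymm s).choose

theorem act_inv_act (hsymm : A.IsSymmetric) (s : S) (w : ℕ → X) :
    A.act (A.inv hsymm s) (A.act s w) = w := by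
  have h : A.actPerm (A.inv hsymm s) = (A.actPerm s)⁻¹ := (hsymm s).choose_spec
  exact (congrFun (congrArg DFunLike.coe h) _).trans ((A.actPerm s).symm_apply_apply w)

/-- The restriction of the inverse acts as the inverse of the restriction; minimality turns this
equality of transformations into one of states. -/
theorem Arrow.inv (hmin : A.IsMinimal) (hsymm : A.IsSymmetric) {s t : S} {x y : X}
    (h : A.Arrow s x y t) : A.Arrow (A.inv hsymm s) y x (A.inv hsymm t) := by
  obtain ⟨rfl, rfl⟩ := h
  have key : ∀ w, A.act (A.next (A.inv hsymm s) (A.out s x)) (A.act (A.next s x) w) = w ∧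
      A.out (A.inv hsymm s) (A.out s x) = x := by
    intro w
    have := act_inv_act hsymm s (snoc w x)
    rw [act_snoc, act_snoc] at this
    exact snoc_injective this
  refine ⟨hmin ?_, (key fun _ => x).2⟩
  funext w
  obtain ⟨w, rfl⟩ := A.act_surjective (A.next s x) w
  rw [(key w).1, act_inv_act]

theorem isTrivial_inv_iff (hsymm : A.IsSymmetric) {s : S} :
    A.IsTrivial (A.inv hsymm s) ↔ A.IsTrivial s := by
  constructor
  · intro h w
    have := act_inv_act hsymm s w
    rwa [h] at this
  · intro h w
    have := act_inv_act hsymm s w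
    rwa [h] at this

theorem inv_actWord (hmin : A.IsMinimal) (hsymm : A.IsSymmetric) (s : S) (v : List X) :
    A.actWord (A.inv hsymm s) (A.actWord s v) = v ∧
      A.restrict (A.inv hsymm s) (A.actWord s v) = A.inv hsymm (A.restrict s v) := by
  induction v generalizing s with
  | nil => exact ⟨rfl, rfl⟩
  | cons x v ih =>
    obtain ⟨h1, h2⟩ := Arrow.inv hmin hsymm (s := s) (x := x) ⟨rfl, rfl⟩
    simp [actWord, h1, h2, ih]

/-! ### Left-infinite paths -/

variable (A) in
/-- A left-infinite path, with states `t` and labels `p|q`. -/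
def LeftPath (t : ℕ → S) (p q : ℕ → X) : Prop := ∀ i, A.Arrow (t (i + 1)) (p i) (q i) (t i)

theorem LeftPath.cons {t : ℕ → S} {p q : ℕ → X} (h : A.LeftPath t p q) (x : X) :
    A.LeftPath (snoc t (A.next (t 0) x)) (snoc p x) (snoc q (A.out (t 0) x)) := by
  intro i
  cases i with
  | zero => exact ⟨rfl, rfl⟩
  | succ i => exact h i

/-- As `p 0` is the last letter, the word read by the last `n` arrows is a reversed prefix. -/
theorem LeftPath.actWord {t : ℕ → S} {p q : ℕ → X} (h : A.LeftPath t p q) (n : ℕ) :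
    A.actWord (t n) (pre p n).reverse = (pre q n).reverse ∧
      A.restrict (t n) (pre p n).reverse = t 0 := by
  induction n with
  | zero => exact ⟨rfl, rfl⟩
  | succ n ih =>
    obtain ⟨h1, h2⟩ := h n
    simp [pre_succ, InvertibleAutomaton.actWord, h1, h2, ih]

/-- Trivial states lead only to trivial ones, so nontriviality propagates backwards. -/
theorem LeftPath.not_isTrivial {t : ℕ → S} {p q : ℕ → X} (h : A.LeftPath t p q)
    (h0 : ¬ A.IsTrivial (t 0)) (i : ℕ) : ¬ A.IsTrivial (t i) := by
  induction i with
  | zero => exact h0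
  | succ i ih => exact fun h' => ih ((h i).1 ▸ h'.next (p i))

theorem LeftPath.mem_postCriticalSet {t : ℕ → S} {p q : ℕ → X} (h : A.LeftPath t p q)
    (h0 : ¬ A.IsTrivial (t 0)) : p ∈ A.postCriticalSet :=
  ⟨t, h.not_isTrivial h0, q, h⟩

theorem LeftPath.inv (hmin : A.IsMinimal) (hsymm : A.IsSymmetric) {t : ℕ → S} {p q : ℕ → X}
    (h : A.LeftPath t p q) : A.LeftPath (fun i => A.inv hsymm (t i)) q p :=
  fun i => (h i).inv hmin hsymm

theorem LeftPath.mem_postCriticalSet_right (hmin : A.IsMinimal) (hsymm : A.IsSymmetric)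
    {t : ℕ → S} {p q : ℕ → X} (h : A.LeftPath t p q) (h0 : ¬ A.IsTrivial (t 0)) :
    q ∈ A.postCriticalSet :=
  (h.inv hmin hsymm).mem_postCriticalSet fun h' => h0 ((isTrivial_inv_iff hsymm).1 h')

/-- Every finite path is the end of a left-infinite path. -/
theorem exists_leftPath (hinc : A.HasIncomingArrows) (s : S) (v : List X) :
    ∃ t p q, A.LeftPath t p q ∧ t 0 = A.restrict s v ∧ (pre p v.length).reverse = v ∧
      (pre q v.length).reverse = A.actWord s v := by
  induction v using List.reverseRecOn with
  | nil =>
    -- Iterating a choice of incoming arrows extends the path indefinitely to the left.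
    choose f g hfg using hinc
    let t : ℕ → S := fun n => f^[n] s
    have ht : ∀ i, A.next (t (i + 1)) (g (t i)) = t i := by
      intro i
      have : t (i + 1) = f (t i) := Function.iterate_succ_apply' f i s
      rw [this, hfg]
    exact ⟨t, fun i => g (t i), fun i => A.out (t (i + 1)) (g (t i)), fun i => ⟨ht i, rfl⟩,
      rfl, rfl, rfl⟩
  | append_singleton v x ih =>
    obtain ⟨t, p, q, h, h0, hp, hq⟩ := ih
    refine ⟨_, _, _, h.cons x, ?_, ?_, ?_⟩
    · rw [restrict_append, ← h0]; rfl
    · rw [List.length_append, List.length_singleton, pre_snoc, List.reverse_cons, hp]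
    · rw [List.length_append, List.length_singleton, pre_snoc, List.reverse_cons, hq,
        actWord_append, ← h0]
      rfl

theorem exists_restrict_eq (hinc : A.HasIncomingArrows) (s : S) (n : ℕ) :
    ∃ t v, v.length = n ∧ A.restrict t v = s := by
  obtain ⟨t, p, q, h, h0, -, -⟩ := exists_leftPath hinc s []
  exact ⟨t n, (pre p n).reverse, by simp, (h.actWord n).2.trans h0⟩

/-! ### Post-critical words -/

variable (A) in
/-- The post-critical words of length `n`: those along which some state does not become trivial. -/
def postWords (n : ℕ) : Set (List X) := {v | v.length = n ∧ ∃ s, ¬ A.IsTrivial (A.restrict s v)}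

theorem reverse_pre_mem_postWords {p : ℕ → X} (hp : p ∈ A.postCriticalSet) (n : ℕ) :
    (pre p n).reverse ∈ A.postWords n := by
  obtain ⟨t, ht, q, h⟩ := hp
  refine ⟨by simp, t n, ?_⟩
  rw [(LeftPath.actWord h n).2]
  exact ht 0

theorem exists_of_mem_postWords (hinc : A.HasIncomingArrows) {n : ℕ} {v : List X}
    (hv : v ∈ A.postWords n) : ∃ p ∈ A.postCriticalSet, (pre p n).reverse = v := by
  obtain ⟨rfl, s, hs⟩ := hv
  obtain ⟨t, p, q, h, h0, hp, -⟩ := exists_leftPath hinc s v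
  exact ⟨p, h.mem_postCriticalSet (h0 ▸ hs), hp⟩

/-- Each post-critical word is the label of a path through nontrivial states, and distinct words
need distinct paths. -/
theorem IsBounded.encard_postWords_le (hbdd : A.IsBounded) :
    ∃ C : ℕ, ∀ n, (A.postWords n).encard ≤ C := by
  obtain ⟨C, hC⟩ := hbdd
  refine ⟨C, fun n => le_trans ?_ (hC n)⟩
  refine le_trans (Set.encard_le_encard ?_)
    (Set.encard_image_le (fun p : (Fin (n + 1) → S) × (Fin n → X) => List.ofFn p.2) _)
  rintro v ⟨rfl, s, hs⟩
  refine ⟨(fun i => A.restrict s (v.take i), fun i => v[i]), ⟨fun i htriv => hs ?_, fun i => ?_⟩, ?_⟩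
  · have := htriv.restrict (v.drop i)
    rwa [← restrict_append, List.take_append_drop] at this
  · have : v.take (i + 1) = v.take i ++ [v[i]] := by simp
    simp only [Fin.val_castSucc, Fin.val_succ]
    rw [this, restrict_append]
    rfl
  · exact List.ofFn_get v

end InvertibleAutomaton

namespace InvertibleAutomaton

variable {S X : Type*} {A : InvertibleAutomaton S X}

/-! ### Tile graphs -/

/-- The inverse state traverses the edge backwards and also ends trivially, so one direction of the
relation suffices. -/
theorem tileGraph_adj (hmin : A.IsMinimal) (hsymm : A.IsSymmetric) {n : ℕ}
    {v u : {v : List X // v.length = n}} :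
    (A.tileGraph n).Adj v u ↔
      v.1 ≠ u.1 ∧ ∃ s, A.actWord s v.1 = u.1 ∧ A.IsTrivial (A.restrict s v.1) := by
  rw [tileGraph, SimpleGraph.fromRel_adj, ← Subtype.coe_ne_coe]
  refine and_congr_right fun _ => ⟨?_, Or.inl⟩
  rintro (h | ⟨s, hs, htriv⟩)
  · exact h
  · obtain ⟨h1, h2⟩ := inv_actWord hmin hsymm s u.1
    rw [hs] at h1 h2
    exact ⟨A.inv hsymm s, h1, h2 ▸ (isTrivial_inv_iff hsymm).2 htriv⟩

variable (A) in
/-- Some tile of some level `k` is not post-critical, and its removal does not separate the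
post-critical vertices of `T_k`. -/
def HasEnclosedTile : Prop :=
  ∃ (k : ℕ) (u : {v : List X // v.length = k}), u.1 ∉ A.postWords k ∧
    ∀ z z' : {v : List X // v.length = k}, z.1 ∈ A.postWords k → z'.1 ∈ A.postWords k →
      (A.tileGraph k).AvoidReach {u} z z'

/-! ### The graph of the action on all sequences -/

variable (A) in
/-- The graph of the action of the states on the space of sequences. -/
def actGraph : SimpleGraph (ℕ → X) := SimpleGraph.fromRel fun v u => ∃ s, A.act s v = u

theorem actGraph_adj (hsymm : A.IsSymmetric) {v u : ℕ → X} :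
    A.actGraph.Adj v u ↔ v ≠ u ∧ ∃ s, A.act s v = u := by
  rw [actGraph, SimpleGraph.fromRel_adj]
  refine and_congr_right fun _ => ⟨?_, Or.inl⟩
  rintro (h | ⟨s, rfl⟩)
  · exact h
  · exact ⟨A.inv hsymm s, act_inv_act hsymm s u⟩

theorem actGraph_avoidReach_act {F : Set (ℕ → X)} (s : S) {v : ℕ → X} (hv : v ∉ F)
    (hu : A.act s v ∉ F) : A.actGraph.AvoidReach F v (A.act s v) := by
  by_cases h : v = A.act s v
  · rw [← h]
    exact .refl
  · exact .single ((SimpleGraph.fromRel_adj _ _ _).2 ⟨h, Or.inl ⟨s, rfl⟩⟩) hv hu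

theorem schreierGraph_adj {w : ℕ → X} {a b : MulAction.orbit A.group w} :
    (A.schreierGraph w).Adj a b ↔ A.actGraph.Adj a.1 b.1 := by
  rw [schreierGraph, actGraph, SimpleGraph.fromRel_adj, SimpleGraph.fromRel_adj,
    ← Subtype.coe_ne_coe]

theorem act_mem_orbit {w v : ℕ → X} (hv : v ∈ MulAction.orbit A.group w) (s : S) :
    A.act s v ∈ MulAction.orbit A.group w := by
  have hs : A.actPerm s ∈ A.group := Subgroup.subset_closure ⟨s, rfl⟩
  exact MulAction.mem_orbit_of_mem_orbit (⟨A.actPerm s, hs⟩ : A.group) hv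

theorem schreierGraph_avoidReach (hsymm : A.IsSymmetric) {w : ℕ → X} {F : Set (ℕ → X)}
    {a b : ℕ → X} (ha : a ∈ MulAction.orbit A.group w) (h : A.actGraph.AvoidReach F a b) :
    ∃ hb : b ∈ MulAction.orbit A.group w,
      (A.schreierGraph w).AvoidReach (Subtype.val ⁻¹' F) ⟨a, ha⟩ ⟨b, hb⟩ := by
  induction h with
  | refl => exact ⟨ha, .refl⟩
  | tail _ h ih =>
    obtain ⟨hb, ih⟩ := ih
    obtain ⟨s, rfl⟩ := ((actGraph_adj hsymm).1 h.1).2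
    exact ⟨act_mem_orbit hb s, ih.tail ⟨schreierGraph_adj.2 h.1, h.2.1, h.2.2⟩⟩

theorem actGraph_reach_smul {g : Equiv.Perm (ℕ → X)} (hg : g ∈ A.group) (v : ℕ → X) :
    A.actGraph.AvoidReach ∅ v (g v) := by
  induction hg using Subgroup.closure_induction generalizing v with
  | mem _ h =>
    obtain ⟨s, rfl⟩ := h
    exact actGraph_avoidReach_act s (Set.notMem_empty _) (Set.notMem_empty _)
  | one => exact .refl
  | mul g h _ _ ihg ihh => exact (ihh v).trans (ihg (h v))
  | inv g _ ih =>
    have := (ih (g⁻¹ v)).symm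
    rwa [show g (g⁻¹ v) = v from g.apply_symm_apply v] at this

theorem schreierGraph_connected (hsymm : A.IsSymmetric) (w : ℕ → X) :
    (A.schreierGraph w).Connected := by
  have key : ∀ a b : MulAction.orbit A.group w, (A.schreierGraph w).AvoidReach ∅ a b →
      (A.schreierGraph w).Reachable a b := by
    intro a b h
    induction h with
    | refl => exact .rfl
    | tail _ h ih => exact ih.trans h.1.reachable
  have hw : ∀ a : MulAction.orbit A.group w,
      (A.schreierGraph w).Reachable ⟨w, MulAction.mem_orbit_self w⟩ a := by
    rintro ⟨_, g, rfl⟩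
    exact key _ _ (schreierGraph_avoidReach hsymm (MulAction.mem_orbit_self w)
      (actGraph_reach_smul g.2 w)).2
  have : Nonempty (MulAction.orbit A.group w) := ⟨⟨w, MulAction.mem_orbit_self w⟩⟩
  exact ⟨fun a b => (hw a).symm.trans (hw b)⟩

theorem schreierGraph_neighbors_finite [Finite S] (hsymm : A.IsSymmetric) (w : ℕ → X)
    (a : MulAction.orbit A.group w) : {b | (A.schreierGraph w).Adj a b}.Finite := by
  refine ((Set.finite_range fun s => A.act s a.1).preimage
    (Subtype.val_injective (p := (· ∈ MulAction.orbit A.group w))).injOn).subset ?_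
  intro b hb
  obtain ⟨s, hs⟩ := ((actGraph_adj hsymm).1 (schreierGraph_adj.1 hb)).2
  exact ⟨s, hs⟩

/-! ### Tiles of sequences -/

/-- The tile of level `n` consisting of the sequences with tail `w`. -/
def tile (n : ℕ) (w : ℕ → X) : Set (ℕ → X) := {v | ∃ y : List X, y.length = n ∧ v = app y w}

theorem tile_finite [Finite X] (n : ℕ) (w : ℕ → X) : (tile n w).Finite := by
  refine ((List.finite_length_eq X n).image fun y => app y w).subset ?_
  rintro _ ⟨y, hy, rfl⟩
  exact ⟨y, hy, rfl⟩

theorem mem_tile_of_eventually_eq {v w : ℕ → X} {n : ℕ} (h : ∀ i, n ≤ i → v i = w i) :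
    v ∈ tile n fun i => w (n + i) := by
  refine ⟨pre v n, pre_length v n, ?_⟩
  conv_lhs => rw [← app_pre v n]
  congr 1
  funext i
  exact h _ (by omega)

/-- An edge of `T_n` ends in a trivial state and so leaves the tail `w` alone: walks of `T_n` lift
to the tile over `w`. -/
theorem actGraph_avoidReach_app {n : ℕ} (hmin : A.IsMinimal) (hsymm : A.IsSymmetric)
    (htile : (A.tileGraph n).Connected) {F : Set (ℕ → X)} {w : ℕ → X}
    (hF : ∀ y : List X, y.length = n → app y w ∉ F) {y y' : List X} (hy : y.length = n)
    (hy' : y'.length = n) : A.actGraph.AvoidReach F (app y w) (app y' w) := by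
  obtain ⟨p⟩ := htile.preconnected ⟨y, hy⟩ ⟨y', hy'⟩
  have key : ∀ a b : {v : List X // v.length = n}, (A.tileGraph n).Walk a b →
      A.actGraph.AvoidReach F (app a.1 w) (app b.1 w) := by
    intro a b p
    induction p with
    | nil => exact .refl
    | @cons a b _ hadj _ ih =>
      obtain ⟨-, s, hs, htriv⟩ := (tileGraph_adj hmin hsymm).1 hadj
      have hact : A.act s (app a.1 w) = app b.1 w := by rw [act_app, hs, htriv]
      refine Relation.ReflTransGen.trans ?_ ih
      have := actGraph_avoidReach_act (F := F) s (hF a.1 a.2) (by rw [hact]; exact hF b.1 b.2)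
      rwa [hact] at this
  exact key _ _ p

theorem app_app_notMem_tile {n : ℕ} {y z u : List X} (hy : y.length = n)
    (hzu : z.length = u.length) (hne : z ≠ u) (w : ℕ → X) :
    app y (app z w) ∉ tile n (app u w) := by
  rintro ⟨y', hy', h⟩
  rw [← app_append, ← app_append] at h
  have := app_left_cancel (by simp [hy, hy', hzu]) h
  exact hne (List.append_inj this (by rw [hy, hy'])).2

/-- Walks in `T_k` avoiding a tile of level `k` give walks avoiding the corresponding tile of
sequences. -/
theorem actGraph_avoidReach_tile (hmin : A.IsMinimal) (hsymm : A.IsSymmetric)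
    (hinc : A.HasIncomingArrows) {n : ℕ} (htile : (A.tileGraph n).Connected) {k : ℕ}
    {u z z' : {v : List X // v.length = k}} (w : ℕ → X) (hz : z ≠ u)
    (h : (A.tileGraph k).AvoidReach {u} z z') {y : List X} (hy : y.length = n) :
    ∀ y' : List X, y'.length = n →
      A.actGraph.AvoidReach (tile n (app u.1 w)) (app y (app z.1 w)) (app y' (app z'.1 w)) := by
  have hout : ∀ z : {v : List X // v.length = k}, z ≠ u → ∀ y : List X, y.length = n →
      app y (app z.1 w) ∉ tile n (app u.1 w) := fun z hz y hy =>
    app_app_notMem_tile hy (by rw [z.2, u.2]) (fun h => hz (Subtype.ext h)) w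
  induction h with
  | refl =>
    intro y' hy'
    exact actGraph_avoidReach_app hmin hsymm htile (hout z hz) hy hy'
  | @tail b c _ hbc ih =>
    intro y' hy'
    obtain ⟨-, s, hs, htriv⟩ := (tileGraph_adj hmin hsymm).1 hbc.1
    -- An edge of `T_k` made by `s` becomes an edge between small tiles: start at a state `t` that
    -- reaches `s` after `n` letters.
    obtain ⟨t, v, hv, hts⟩ := exists_restrict_eq hinc s n
    have hact : A.act t (app v (app b.1 w)) = app (A.actWord t v) (app c.1 w) := by
      rw [act_app, hts, act_app, hs, htriv]
    have hc : (A.actWord t v).length = n := by simp [hv]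
    refine (ih v hv).trans (Relation.ReflTransGen.trans ?_
      (actGraph_avoidReach_app hmin hsymm htile (hout c hbc.2.2) hc hy'))
    have := actGraph_avoidReach_act (F := tile n (app u.1 w)) t (hout b hbc.2.1 v hv)
      (by rw [hact]; exact hout c hbc.2.2 _ hc)
    rwa [hact] at this

/-- A walk entering a tile does so through a post-critical vertex. -/
theorem actGraph_avoidReach_postWords (hsymm : A.IsSymmetric) {m : ℕ} {w : ℕ → X}
    {F : Set (ℕ → X)} (hF : F ⊆ tile m w) (hpF : ∀ b ∈ A.postWords m, app b w ∉ F)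
    {a c : ℕ → X} (h : A.actGraph.AvoidReach ∅ a c) (hc : c ∈ tile m w) (ha : a ∉ tile m w) :
    ∃ b ∈ A.postWords m, A.actGraph.AvoidReach F a (app b w) := by
  induction h using Relation.ReflTransGen.head_induction_on with
  | refl => exact absurd hc ha
  | @head a c hac _ ih =>
    by_cases hct : c ∈ tile m w
    · obtain ⟨b, hb, rfl⟩ := hct
      obtain ⟨-, s, hs⟩ := (actGraph_adj hsymm).1 hac.1.symm
      have hbp : b ∈ A.postWords m := by
        -- A trivial restriction along `b` would keep the tail `w`, so the edge could not leave the
        -- tile.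
        refine ⟨hb, s, fun htriv => ha ⟨A.actWord s b, by simp [hb], ?_⟩⟩
        rw [← hs, act_app, htriv]
      exact ⟨b, hbp, .single hac.1 (fun h => ha (hF h)) (hpF b hbp)⟩
    · obtain ⟨b, hb, hcb⟩ := ih hct
      exact ⟨b, hb, .head ⟨hac.1, fun h => ha (hF h), fun h => hct (hF h)⟩ hcb⟩

/-! ### Regular sequences -/

variable (A) in
/-- Every state has a trivial restriction along every sequence of the orbit. -/
def IsRegularSeq (w : ℕ → X) : Prop :=
  ∀ v ∈ MulAction.orbit A.group w, ∀ s, ∃ n, A.IsTrivial (A.restrict s (pre v n))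

/-- A generator changes finitely many letters of any sequence in the orbit. Regularity along the
whole orbit lets this pass to products and inverses. -/
theorem IsRegularSeq.eventually_eq {w : ℕ → X} (hw : A.IsRegularSeq w) {v : ℕ → X}
    (hv : v ∈ MulAction.orbit A.group w) : ∃ N, ∀ i, N ≤ i → v i = w i := by
  have key : ∀ g ∈ A.group, ∀ v ∈ MulAction.orbit A.group w, ∃ N, ∀ i, N ≤ i → g v i = v i := by
    intro g hg
    induction hg using Subgroup.closure_induction with
    | mem _ h =>
      obtain ⟨s, rfl⟩ := h
      intro v hv
      obtain ⟨n, hn⟩ := hw v hv s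
      refine ⟨n, fun i hi => ?_⟩
      have htriv := hn.restrict_pre_of_le hi
      exact htriv.out_eq (v i)
    | one => exact fun v _ => ⟨0, fun i _ => rfl⟩
    | mul g h _ hh ihg ihh =>
      intro v hv
      obtain ⟨M, hM⟩ := ihh v hv
      obtain ⟨N, hN⟩ := ihg (h v) (MulAction.mem_orbit_of_mem_orbit (⟨h, hh⟩ : A.group) hv)
      refine ⟨max M N, fun i hi => ?_⟩
      exact (hN i (le_trans (le_max_right _ _) hi)).trans (hM i (le_trans (le_max_left _ _) hi))
    | inv g hg ih =>
      intro v hv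
      obtain ⟨N, hN⟩ := ih (g⁻¹ v)
        (MulAction.mem_orbit_of_mem_orbit ((⟨g, hg⟩ : A.group)⁻¹) hv)
      rw [show g (g⁻¹ v) = v from g.apply_symm_apply v] at hN
      exact ⟨N, fun i hi => (hN i hi).symm⟩
  obtain ⟨g, rfl⟩ := hv
  exact key g.1 g.2 w (MulAction.mem_orbit_self w)

theorem mem_orbit_of_eventually_eq (hmin : A.IsMinimal) (hsymm : A.IsSymmetric)
    (htile : ∀ n, (A.tileGraph n).Connected) {v w : ℕ → X} {n : ℕ}
    (h : ∀ i, n ≤ i → v i = w i) : v ∈ MulAction.orbit A.group w := by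
  obtain ⟨y, hy, hv⟩ := mem_tile_of_eventually_eq h
  have := actGraph_avoidReach_app hmin hsymm (htile n) (F := ∅) (w := fun i => w (n + i))
    (fun _ _ => Set.notMem_empty _) (pre_length w n) hy
  rw [app_pre, ← hv] at this
  exact (schreierGraph_avoidReach hsymm (MulAction.mem_orbit_self w) this).1

theorem orbit_infinite [Nontrivial X] (hmin : A.IsMinimal) (hsymm : A.IsSymmetric)
    (htile : ∀ n, (A.tileGraph n).Connected) (w : ℕ → X) :
    Infinite (MulAction.orbit A.group w) := by
  classical
  choose f hf using fun x : X => exists_ne x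
  refine Infinite.of_injective (fun n : ℕ => (⟨Function.update w n (f (w n)),
    mem_orbit_of_eventually_eq hmin hsymm htile (n := n + 1) fun i hi =>
      Function.update_of_ne (by omega) _ _⟩ : MulAction.orbit A.group w)) ?_
  intro m n hmn
  by_contra hne
  have := congrFun (Subtype.ext_iff.1 hmn) m
  simp only [Function.update_self, Function.update_of_ne hne] at this
  exact hf _ this

/-- A finite set sits in the level `n` tile over `u w'`, for a late occurrence of `u` in `w`.
Vertices outside the level `n + k` tile over `w'` walk to its post-critical vertices, which `hsep`
connects around the small tile. -/
theorem IsRegularSeq.numEnds_eq_one [Finite S] [Finite X] [Nontrivial X] (hmin : A.IsMinimal)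
    (hsymm : A.IsSymmetric) (htile : ∀ n, (A.tileGraph n).Connected)
    (hinc : A.HasIncomingArrows) {w : ℕ → X} (hw : A.IsRegularSeq w) {k : ℕ}
    {u : {v : List X // v.length = k}} (hu : u.1 ∉ A.postWords k)
    (hsep : ∀ z z' : {v : List X // v.length = k}, z.1 ∈ A.postWords k → z'.1 ∈ A.postWords k →
      (A.tileGraph k).AvoidReach {u} z z')
    (hocc : ∀ N, ∃ n, N ≤ n ∧ pre (fun i => w (n + i)) k = u.1) :
    (A.schreierGraph w).numEnds = 1 := by
  have := orbit_infinite hmin hsymm htile w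
  refine (schreierGraph_connected hsymm w).numEnds_eq_one
    (schreierGraph_neighbors_finite hsymm w) fun F => ?_
  obtain ⟨N, hN⟩ : ∃ N, ∀ v ∈ F, ∀ i, N ≤ i → v.1 i = w i := by
    choose g hg using fun v : MulAction.orbit A.group w => hw.eventually_eq v.2
    exact ⟨F.sup g, fun v hv i hi => hg v i ((Finset.le_sup hv).trans hi)⟩
  obtain ⟨n, hn, hnu⟩ := hocc N
  set w' : ℕ → X := fun i => w (n + (k + i)) with hw'
  have htail : (fun i => w (n + i)) = app u.1 w' := by
    rw [← hnu]
    exact (app_pre (fun i => w (n + i)) k).symm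
  have hwtile : w ∈ tile (n + k) w' :=
    ⟨pre w n ++ u.1, by simp [u.2], by rw [app_append, ← htail, app_pre]⟩
  have hsub : tile n (app u.1 w') ⊆ tile (n + k) w' := by
    rintro _ ⟨y, hy, rfl⟩
    exact ⟨y ++ u.1, by simp [hy, u.2], (app_append _ _ _).symm⟩
  -- An ending of a post-critical word is post-critical, so entrances to the large tile lie in small
  -- tiles other than that of `u`.
  have hpost : ∀ b ∈ A.postWords (n + k), ∃ y : List X, ∃ z : {v : List X // v.length = k},
      y.length = n ∧ z.1 ∈ A.postWords k ∧ b = y ++ z.1 := by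
    rintro b ⟨hb, s, hs⟩
    have hz : (b.drop n).length = k := by simp [hb]
    refine ⟨b.take n, ⟨b.drop n, hz⟩, by simp [hb], ⟨hz, A.restrict s (b.take n), ?_⟩,
      (List.take_append_drop n b).symm⟩
    rwa [← restrict_append, List.take_append_drop]
  have hne : ∀ z : {v : List X // v.length = k}, z.1 ∈ A.postWords k → z ≠ u := by
    rintro z hz rfl
    exact hu hz
  have hpF : ∀ b ∈ A.postWords (n + k), app b w' ∉ tile n (app u.1 w') := by
    intro b hb
    obtain ⟨y, z, hy, hz, rfl⟩ := hpost b hb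
    rw [app_append]
    exact app_app_notMem_tile hy (by rw [z.2, u.2]) (fun h => hne z hz (Subtype.ext h)) w'
  have hfin : (Subtype.val ⁻¹' tile (n + k) w' : Set (MulAction.orbit A.group w)).Finite :=
    (tile_finite (n + k) w').preimage Subtype.val_injective.injOn
  refine ⟨hfin.toFinset, fun a b ha hb => ?_⟩
  rw [Set.Finite.mem_toFinset] at ha hb
  have hreach : ∀ a : MulAction.orbit A.group w, A.actGraph.AvoidReach ∅ a.1 w := by
    rintro ⟨_, g, rfl⟩
    exact (actGraph_reach_smul g.2 w).symm
  obtain ⟨p, hp, hap⟩ := actGraph_avoidReach_postWords hsymm hsub hpF (hreach a) hwtile ha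
  obtain ⟨q, hq, hbq⟩ := actGraph_avoidReach_postWords hsymm hsub hpF (hreach b) hwtile hb
  obtain ⟨y, z, hy, hz, rfl⟩ := hpost p hp
  obtain ⟨y', z', hy', hz', rfl⟩ := hpost q hq
  rw [app_append] at hap hbq
  have hmid := actGraph_avoidReach_tile hmin hsymm hinc (htile n) w' (hne z hz) (hsep z z' hz hz')
    hy y' hy'
  obtain ⟨_, h⟩ := schreierGraph_avoidReach hsymm a.2 ((hap.trans hmid).trans hbq.symm)
  refine h.mono le_rfl ?_
  intro v hv
  have := mem_tile_of_eventually_eq (n := n) (fun i hi => hN v hv i (hn.trans hi))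
  rwa [htail] at this

/-! ### Comparison of Schreier graphs and tile graphs -/

theorem IsRegularSeq.tileGraphOnOrbit_eq {w : ℕ → X} (hw : A.IsRegularSeq w) :
    A.tileGraphOnOrbit w = A.schreierGraph w := by
  unfold tileGraphOnOrbit schreierGraph
  congr 1
  funext v u
  exact propext ⟨fun ⟨s, h, _⟩ => ⟨s, h⟩, fun ⟨s, h⟩ => ⟨s, h, hw v.1 v.2 s⟩⟩

theorem IsRegularSeq.numEnds_orbitalTileGraph (hsymm : A.IsSymmetric) {w : ℕ → X}
    (hw : A.IsRegularSeq w) : (A.orbitalTileGraph w).numEnds = (A.schreierGraph w).numEnds := by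
  have hc : (A.tileGraphOnOrbit w).Connected := by
    rw [hw.tileGraphOnOrbit_eq]
    exact schreierGraph_connected hsymm w
  rw [← hw.tileGraphOnOrbit_eq]
  refine SimpleGraph.numEnds_congr ⟨Equiv.subtypeUnivEquiv fun v => ?_, Iff.rfl⟩
  exact SimpleGraph.ConnectedComponent.sound (hc.preconnected _ _)

theorem group_countable [Finite S] : Countable A.group := by
  have : Countable (FreeGroup S) := Quotient.countable (α := List (S × Bool))
  have h : (FreeGroup.lift A.actPerm).range = A.group := FreeGroup.range_lift_eq_closure
  rw [← h]
  exact (MonoidHom.rangeRestrict_surjective _).countable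

/-- Sequences along which some state never becomes trivial have only post-critical prefixes, so they
are finitely many; an irregular sequence lies in one of their countable orbits. -/
theorem countable_not_isRegularSeq [Finite S] (hbdd : A.IsBounded) :
    {w | ¬ A.IsRegularSeq w}.Countable := by
  obtain ⟨C, hC⟩ := hbdd.encard_postWords_le
  set B : Set (ℕ → X) := {v | ∃ s, ∀ n, ¬ A.IsTrivial (A.restrict s (pre v n))} with hB
  have hBfin : B.Finite := by
    refine Set.finite_of_encard_le_coe (k := C) (encard_le_of_pre fun n _ => ?_)
    refine le_trans (Set.encard_le_encard ?_) (hC n)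
    rintro _ ⟨v, ⟨s, hs⟩, rfl⟩
    exact ⟨pre_length v n, s, hs n⟩
  have := group_countable (A := A)
  refine (hBfin.countable.biUnion fun v _ =>
    Set.countable_range fun g : A.group => g • v).mono ?_
  intro w hw
  simp only [IsRegularSeq, Set.mem_ofPred_eq] at hw
  push Not at hw
  obtain ⟨v, hv, s, hs⟩ := hw
  exact Set.mem_biUnion (x := v) ⟨s, hs⟩ (MulAction.mem_orbit_symm.1 hv)

end InvertibleAutomaton

/-! ### Cylinders and recurring words for the Bernoulli measure -/

section Bernoulli

variable {X : Type*} [Fintype X] [Nonempty X] [MeasurableSpace X] [DiscreteMeasurableSpace X]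

/-- The measure of a cylinder. -/
theorem uniformBernoulli_pi_singleton (I : Finset ℕ) (u : ℕ → X) :
    uniformBernoulli X (Set.pi I fun i => {u i}) = ((Fintype.card X : ENNReal)⁻¹) ^ I.card := by
  rw [uniformBernoulli, Measure.infinitePi_pi (fun _ : ℕ => (PMF.uniformOfFintype X).toMeasure)
    fun i _ => measurableSet_singleton _]
  simp_rw [PMF.toMeasure_apply_singleton _ _ (measurableSet_singleton _),
    PMF.uniformOfFintype_apply, Finset.prod_const]

instance uniformBernoulli_nullSingletonClass [Nontrivial X] : NullSingletonClass (uniformBernoulli X) := by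
  refine ⟨fun w => ?_⟩
  have hc : (Fintype.card X : ENNReal)⁻¹ < 1 :=
    ENNReal.inv_lt_one.2 (by exact_mod_cast Fintype.one_lt_card)
  refine le_antisymm (ge_of_tendsto' (ENNReal.tendsto_pow_atTop_nhds_zero_of_lt_one hc)
    fun n => ?_) zero_le
  rw [← Finset.card_range n, ← uniformBernoulli_pi_singleton (Finset.range n) w]
  refine measure_mono ?_
  rintro _ rfl i _
  rfl

/-- Almost every sequence contains a given word at infinitely many positions. -/
theorem ae_frequently_eq_block (K : ℕ) (u : ℕ → X) :
    ∀ᵐ w ∂uniformBernoulli X, ∃ᶠ j in Filter.atTop, ∀ i < K, w (j * K + i) = u i := by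
  -- Disjoint blocks give independent events of equal positive probability, ready for the second
  -- Borel–Cantelli lemma.
  let block : ℕ → Finset ℕ := fun j => Finset.Ico (j * K) (j * K + K)
  let E : ℕ → Set (ℕ → X) := fun j => Set.pi (block j) fun m => {u (m % K)}
  have hmem : ∀ j m, m ∈ block j → m / K = j := by
    intro j m hm
    simp only [block, Finset.mem_Ico] at hm
    refine Nat.div_eq_of_lt_le hm.1 ?_
    rw [Nat.succ_mul]
    exact hm.2
  have hmeas : ∀ j, MeasurableSet (E j) := fun j =>
    MeasurableSet.pi (block j).countable_toSet fun i _ => measurableSet_singleton _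
  have hE : ∀ j, uniformBernoulli X (E j) = ((Fintype.card X : ENNReal)⁻¹) ^ K := by
    intro j
    rw [uniformBernoulli_pi_singleton (block j) fun m => u (m % K)]
    simp [block]
  have hind : ProbabilityTheory.iIndepSet E (uniformBernoulli X) := by
    rw [ProbabilityTheory.iIndepSet_iff_meas_biInter hmeas]
    intro J
    have hU : (⋂ j ∈ J, E j) = Set.pi (J.biUnion block) fun m => {u (m % K)} := by
      ext w
      simp only [E, Set.mem_iInter, Set.mem_pi, Finset.mem_coe, Finset.mem_biUnion]
      exact ⟨fun h m ⟨j, hj, hm⟩ => h j hj m hm, fun h j hj m hm => h m ⟨j, hj, hm⟩⟩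
    have hdisj : (J : Set ℕ).PairwiseDisjoint block := by
      intro i _ j _ hij
      refine Finset.disjoint_left.2 fun m hi hj => hij ?_
      rw [← hmem i m hi, ← hmem j m hj]
    rw [hU, uniformBernoulli_pi_singleton (J.biUnion block) fun m => u (m % K),
      Finset.card_biUnion hdisj]
    simp [hE, block, pow_mul, mul_comm]
  have hsum : ∑' j, uniformBernoulli X (E j) = ⊤ := by
    simp only [hE]
    exact ENNReal.tsum_const_eq_top_of_ne_zero
      (pow_ne_zero _ (ENNReal.inv_ne_zero.2 (ENNReal.natCast_ne_top _)))
  have h1 := ProbabilityTheory.measure_limsup_eq_one hmeas hind hsum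
  have hml : MeasurableSet (Filter.limsup E Filter.atTop) := MeasurableSet.measurableSet_limsup hmeas
  filter_upwards [(prob_compl_eq_zero_iff hml).2 h1 |> fun h => measure_eq_zero_iff_ae_notMem.1 h]
    with w hw
  rw [Set.mem_compl_iff, not_not, Filter.mem_limsup_iff_frequently_mem] at hw
  refine hw.mono fun j hj i hi => ?_
  have := hj (j * K + i) (by simp [block, hi])
  simpa [Nat.mod_eq_of_lt hi] using this

end Bernoulli

/-! ### Almost sure consequences -/

namespace InvertibleAutomaton

variable {S X : Type*} [Finite S] [Fintype X] [Nontrivial X] [MeasurableSpace X]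
  [DiscreteMeasurableSpace X] {A : InvertibleAutomaton S X}

theorem ae_isRegularSeq (hbdd : A.IsBounded) : ∀ᵐ w ∂uniformBernoulli X, A.IsRegularSeq w :=
  (countable_not_isRegularSeq hbdd).measure_zero _

theorem HasEnclosedTile.ae_numEnds_eq_one (h : A.HasEnclosedTile) (hmin : A.IsMinimal)
    (hbdd : A.IsBounded) (htile : ∀ n, (A.tileGraph n).Connected) (hinc : A.HasIncomingArrows)
    (hsymm : A.IsSymmetric) : ∀ᵐ w ∂uniformBernoulli X, (A.schreierGraph w).numEnds = 1 := by
  obtain ⟨k, u, hu, hsep⟩ := h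
  obtain ⟨x⟩ : Nonempty X := inferInstance
  -- Blocks of length `k + 1` keep the positions `j * (k + 1)` unbounded even when `k = 0`.
  filter_upwards [ae_isRegularSeq hbdd,
    ae_frequently_eq_block (k + 1) (app u.1 fun _ => x)] with w hw hocc
  refine hw.numEnds_eq_one hmin hsymm htile hinc hu hsep fun N => ?_
  obtain ⟨j, hj, hw⟩ := Filter.frequently_atTop.1 hocc N
  refine ⟨j * (k + 1), hj.trans (Nat.le_mul_of_pos_right _ k.succ_pos), ?_⟩
  have hpre := pre_app u.1 fun _ => x
  rw [u.2] at hpre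
  rw [← hpre]
  exact pre_eq_iff.2 fun i hi => hw i (by omega)

end InvertibleAutomaton

/-- A finite connected graph of maximal degree two has at most two vertices of degree one. -/
theorem SimpleGraph.Connected.ncard_le_two {V : Type*} [Finite V] {G : SimpleGraph V}
    (hG : G.Connected)
    (hdeg : ∀ v x y z, G.Adj v x → G.Adj v y → G.Adj v z → x = y ∨ x = z ∨ y = z)
    {P : Set V} (hP : ∀ v ∈ P, ∀ x y, G.Adj v x → G.Adj v y → x = y) : P.ncard ≤ 2 := by
  classical
  have := Fintype.ofFinite V
  have hE := hG.card_vert_le_card_edgeSet_add_one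
  have hsum := G.sum_degrees_eq_twice_card_edges
  rw [Nat.card_eq_fintype_card, Nat.card_eq_fintype_card, ← G.edgeFinset_card] at hE
  -- Connectedness forces a degree sum of at least `2|V| - 2`, leaving room for two vertices in `P`.
  have hle : ∑ v : V, (G.degree v + if v ∈ P.toFinset then 1 else 0) ≤ ∑ _v : V, 2 := by
    refine Finset.sum_le_sum fun v _ => ?_
    simp only [Set.mem_toFinset]
    split_ifs with hv
    · rw [← G.card_neighborFinset_eq_degree]
      refine Nat.add_le_add_right (Finset.card_le_one.2 fun x hx y hy => ?_) 1
      exact hP v hv x y (by simpa using hx) (by simpa using hy)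
    · rw [← G.card_neighborFinset_eq_degree]
      by_contra! hlt
      obtain ⟨x, hx, y, hy, z, hz, hxy, hxz, hyz⟩ := Finset.two_lt_card.1 hlt
      rcases hdeg v x y z (by simpa using hx) (by simpa using hy) (by simpa using hz) with
        h | h | h
      · exact hxy h
      · exact hxz h
      · exact hyz h
  simp only [Finset.sum_add_distrib, Finset.sum_const, Finset.card_univ, smul_eq_mul,
    Finset.sum_ite_mem, Finset.univ_inter, mul_one] at hle
  rw [Set.ncard_eq_toFinset_card']
  omega

namespace InvertibleAutomaton

variable {S X : Type*} {A : InvertibleAutomaton S X}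

/-! ### Copies of a tile graph inside those of higher level -/

instance vertex_finite [Finite X] (n : ℕ) : Finite {v : List X // v.length = n} :=
  (List.finite_length_eq X n).to_subtype

theorem vertex_nontrivial [Nontrivial X] {n : ℕ} (hn : 1 ≤ n) :
    Nontrivial {v : List X // v.length = n} := by
  obtain ⟨x, y, hxy⟩ := exists_pair_ne X
  refine ⟨⟨List.replicate n x, by simp⟩, ⟨List.replicate n y, by simp⟩, fun h => hxy ?_⟩
  exact (List.replicate_right_inj (by omega : n ≠ 0)).1 (congrArg Subtype.val h)

/-- The vertex `vz` of the tile with address `z`. -/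
def appendVertex {k l : ℕ} (v : {v : List X // v.length = k}) (z : {v : List X // v.length = l}) :
    {v : List X // v.length = k + l} := ⟨v.1 ++ z.1, by simp [v.2, z.2]⟩

theorem appendVertex_inj {k l : ℕ} {v v' : {v : List X // v.length = k}}
    {z z' : {v : List X // v.length = l}} (h : appendVertex v z = appendVertex v' z') :
    v = v' ∧ z = z' := by
  obtain ⟨h1, h2⟩ := List.append_inj (congrArg Subtype.val h) (v.2.trans v'.2.symm)
  exact ⟨Subtype.ext h1, Subtype.ext h2⟩

/-- The state is already trivial when it reaches `z`. Hence `T_{k+l}` contains one disjoint copy of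
`T_k` for each `z`. -/
theorem tileGraph_adj_appendVertex (hmin : A.IsMinimal) (hsymm : A.IsSymmetric) {k l : ℕ}
    {v u : {v : List X // v.length = k}} (h : (A.tileGraph k).Adj v u)
    (z : {v : List X // v.length = l}) :
    (A.tileGraph (k + l)).Adj (appendVertex v z) (appendVertex u z) := by
  obtain ⟨hne, s, hs, htriv⟩ := (tileGraph_adj hmin hsymm).1 h
  refine (tileGraph_adj hmin hsymm).2 ⟨fun h => hne (List.append_inj h (v.2.trans u.2.symm)).1,
    s, ?_, ?_⟩
  · simp [appendVertex, actWord_append, hs, htriv.actWord_eq]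
  · simp only [appendVertex, restrict_append]
    exact htriv.restrict _

theorem exists_card_words_gt [Finite X] [Nontrivial X] (C : ℕ) :
    ∃ n, 1 ≤ n ∧ C < Nat.card (Fin n → X) := by
  refine ⟨C + 1, by omega, ?_⟩
  rw [Nat.card_fun, Nat.card_fin]
  exact (Nat.lt_succ_self C).trans (Nat.lt_pow_self Finite.one_lt_card)

theorem actWord_pre (s : S) (w : ℕ → X) (n : ℕ) : A.actWord s (pre w n) = pre (A.act s w) n := by
  conv_rhs => rw [← app_pre w n, act_app]
  have := pre_app (A.actWord s (pre w n))
    (A.act (A.restrict s (pre w n)) fun i => w (n + i))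
  rw [actWord_length, pre_length] at this
  exact this.symm

/-- A nontrivial state of a bounded automaton moves some word along which it becomes trivial. -/
theorem exists_actWord_ne [Finite X] [Nontrivial X] (hbdd : A.IsBounded) {s : S}
    (hs : ¬ A.IsTrivial s) : ∃ z, A.actWord s z ≠ z ∧ A.IsTrivial (A.restrict s z) := by
  obtain ⟨C, hC⟩ := hbdd.encard_postWords_le
  simp only [IsTrivial, not_forall] at hs
  obtain ⟨w, hw⟩ := hs
  obtain ⟨i, hi⟩ := Function.ne_iff.1 hw
  set v := pre w (i + 1) with hv
  have hmove : A.actWord s v ≠ v := by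
    rw [hv, actWord_pre]
    exact fun h => hi (pre_eq_iff.1 h i (Nat.lt_succ_self i))
  obtain ⟨n, -, hn⟩ := exists_card_words_gt (X := X) C
  by_contra! hcon
  -- All continuations of the moved word `v` are moved too; if `s` stayed nontrivial along them all,
  -- the post-critical words would outnumber `C`.
  have hsub : Set.range (fun f : Fin n → X => v ++ List.ofFn f) ⊆ A.postWords (i + 1 + n) := by
    rintro _ ⟨f, rfl⟩
    refine ⟨by simp [hv], s, hcon _ fun h => hmove ?_⟩
    rw [actWord_append] at h
    exact (List.append_inj h (by simp)).1
  have hinj : Function.Injective fun f : Fin n → X => v ++ List.ofFn f := fun f g h =>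
    List.ofFn_injective (List.append_cancel_left h)
  have := (Set.encard_le_encard hsub).trans (hC _)
  rw [← Set.image_univ, hinj.encard_image, Set.encard_univ, ENat.card_eq_coe_natCard] at this
  exact absurd (Nat.cast_le.1 this) (by omega)

/-! ### Automata without enclosed tiles -/

variable (A) in
/-- The post-critical vertices of the tile graph `T_n`. -/
def postVertices (n : ℕ) : Set {v : List X // v.length = n} := {v | v.1 ∈ A.postWords n}

theorem encard_postVertices (n : ℕ) : (A.postVertices n).encard = (A.postWords n).encard := by
  rw [← Subtype.val_injective.encard_image (A.postVertices n)]
  congr 1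
  ext v
  exact ⟨fun ⟨_, hu, h⟩ => h ▸ hu, fun hv => ⟨⟨v, hv.1⟩, hv, rfl⟩⟩

theorem exists_separated (h : ¬ A.HasEnclosedTile) {n : ℕ} (v : {v : List X // v.length = n})
    (hv : v ∉ A.postVertices n) : ∃ z ∈ A.postVertices n, ∃ z' ∈ A.postVertices n,
      ¬ (A.tileGraph n).AvoidReach {v} z z' := by
  by_contra! hcon
  exact h ⟨n, v, hv, fun z z' hz hz' => hcon z hz z' hz'⟩

section NoEnclosedTile

variable [Finite X] [Nontrivial X] (hmin : A.IsMinimal) (hbdd : A.IsBounded)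
  (htile : ∀ n, (A.tileGraph n).Connected) (hinc : A.HasIncomingArrows) (hsymm : A.IsSymmetric)
  (h : ¬ A.HasEnclosedTile)

include hmin hbdd htile hsymm h

/-- A vertex with three neighbours gives `|X|^l` disjoint stars in `T_{n+l}`, while a spanning tree
admits fewer branchings than there are post-critical words, a bounded number. -/
theorem tileGraph_degree_le_two {n : ℕ} (v x y z : {v : List X // v.length = n})
    (hx : (A.tileGraph n).Adj v x) (hy : (A.tileGraph n).Adj v y) (hz : (A.tileGraph n).Adj v z) :
    x = y ∨ x = z ∨ y = z := by
  by_contra! hne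
  obtain ⟨hxy, hxz, hyz⟩ := hne
  obtain ⟨C, hC⟩ := hbdd.encard_postWords_le
  obtain ⟨l, hl, hlC⟩ := exists_card_words_gt (X := X) C
  have := vertex_nontrivial (X := X) (n := n + l) (by omega)
  let e : (Fin l → X) → {v : List X // v.length = l} := fun f => ⟨List.ofFn f, by simp⟩
  have he : Function.Injective e := fun f g hfg => List.ofFn_injective (congrArg Subtype.val hfg)
  let g : Fin 3 → {v : List X // v.length = n} := ![x, y, z]
  have hg : ∀ j, (A.tileGraph n).Adj v (g j) := by
    intro j
    fin_cases j
    · exact hx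
    · exact hy
    · exact hz
  have hginj : Function.Injective g := by
    intro i j hij
    fin_cases i <;> fin_cases j <;> simp_all [g]
  have hstars := (htile (n + l)).card_stars_add_two_le (exists_separated h)
    (fun f => appendVertex v (e f)) (fun f j => appendVertex (g j) (e f))
    (fun f j => tileGraph_adj_appendVertex hmin hsymm (hg j) (e f))
    (fun f i j hij => hginj (appendVertex_inj hij).1)
    (fun f f' hf => he (appendVertex_inj hf).2)
    (fun f f' j hj => (hg j).ne (appendVertex_inj hj).1)
    (fun f f' j j' hj => he (appendVertex_inj hj).2)
  have hP := hC (n + l)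
  rw [← encard_postVertices, ← (Set.toFinite (A.postVertices (n + l))).cast_ncard_eq] at hP
  have := Nat.cast_le.1 hP
  omega

/-- A state still nontrivial after `v` moves some `z` and then dies, so `vz` has a neighbour outside
its own copy of `T_n`. Only one is left inside. -/
theorem postVertices_degree_le_one {n : ℕ} (v : {v : List X // v.length = n})
    (hv : v ∈ A.postVertices n) (x y : {v : List X // v.length = n})
    (hx : (A.tileGraph n).Adj v x) (hy : (A.tileGraph n).Adj v y) : x = y := by
  obtain ⟨-, s, hs⟩ := hv
  obtain ⟨z, hz, htriv⟩ := exists_actWord_ne hbdd hs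
  let z' : {v : List X // v.length = z.length} := ⟨z, rfl⟩
  let u : {v : List X // v.length = n} := ⟨A.actWord s v.1, by simp [v.2]⟩
  let t : {v : List X // v.length = z.length} := ⟨A.actWord (A.restrict s v.1) z, by simp⟩
  have htz : t ≠ z' := fun h => hz (congrArg Subtype.val h)
  have hadj : (A.tileGraph (n + z.length)).Adj (appendVertex v z') (appendVertex u t) := by
    refine (tileGraph_adj hmin hsymm).2
      ⟨fun h => htz (appendVertex_inj (Subtype.ext h)).2.symm, s, ?_, ?_⟩
    · exact actWord_append A s v.1 z
    · show A.IsTrivial (A.restrict s (v.1 ++ z))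
      rwa [restrict_append]
  rcases tileGraph_degree_le_two hmin hbdd htile hsymm h _ _ _ _ hadj
    (tileGraph_adj_appendVertex hmin hsymm hx z') (tileGraph_adj_appendVertex hmin hsymm hy z')
    with h | h | h
  · exact absurd (appendVertex_inj h).2 htz
  · exact absurd (appendVertex_inj h).2 htz
  · exact (appendVertex_inj h).1

/-- The degree bounds give at most two; a spanning tree has at least two leaves, all post-critical.
For `n = 0` there is only one vertex. -/
theorem encard_postWords_eq_two {n : ℕ} (hn : 1 ≤ n) : (A.postWords n).encard = 2 := by
  have := vertex_nontrivial (X := X) hn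
  have hle := (htile n).ncard_le_two (tileGraph_degree_le_two hmin hbdd htile hsymm h)
    (postVertices_degree_le_one hmin hbdd htile hsymm h)
  obtain ⟨T, hTG, hT⟩ := (htile n).exists_isTree_le
  have hge := hT.card_branch_add_two_le hTG (exists_separated h)
  rw [← encard_postVertices, ← (Set.toFinite (A.postVertices n)).cast_ncard_eq]
  have : (A.postVertices n).ncard = 2 := by omega
  rw [this]
  rfl

include hinc

theorem encard_image_pre {n : ℕ} (hn : 1 ≤ n) :
    ((fun p => pre p n) '' A.postCriticalSet).encard = 2 := by
  rw [← encard_postWords_eq_two hmin hbdd htile hsymm h hn,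
    ← List.reverse_injective.encard_image, Set.image_image]
  congr 1
  ext v
  constructor
  · rintro ⟨p, hp, rfl⟩
    exact reverse_pre_mem_postWords hp n
  · intro hv
    obtain ⟨p, hp, hpv⟩ := exists_of_mem_postWords hinc hv
    exact ⟨p, hp, hpv⟩

theorem encard_postCriticalSet_eq_two : A.postCriticalSet.encard = 2 := by
  refine le_antisymm (encard_le_of_pre (C := 2) fun n hn =>
    (encard_image_pre hmin hbdd htile hinc hsymm h hn).le) ?_
  rw [← encard_image_pre hmin hbdd htile hinc hsymm h le_rfl]
  exact Set.encard_image_le _ _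

/-- The two post-critical sequences have two distinct endings already at length one. -/
theorem postCriticalSet_ext {p q : ℕ → X} (hp : p ∈ A.postCriticalSet)
    (hq : q ∈ A.postCriticalSet) (hpq : p 0 = q 0) : p = q := by
  have h2 := encard_postCriticalSet_eq_two hmin hbdd htile hinc hsymm h
  have hfin : A.postCriticalSet.Finite := Set.finite_of_encard_eq_coe (k := 2) h2
  refine hfin.injOn_of_encard_image_eq
    ((encard_image_pre hmin hbdd htile hinc hsymm h le_rfl).trans h2.symm) hp hq ?_
  exact pre_eq_iff.2 fun i hi => by rwa [Nat.lt_one_iff.1 hi]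

end NoEnclosedTile

/-! ### The augmented model graph -/

theorem augmentedModelGraph_adj {a b : A.postCriticalSet × X} :
    A.augmentedModelGraph.Adj a b ↔
      a ≠ b ∧ (a.2 = b.2 ∨ A.ModelEdge a b ∨ A.ModelEdge b a) := by
  simp only [augmentedModelGraph, modelGraph, SimpleGraph.sup_adj, SimpleGraph.fromRel_adj]
  constructor
  · rintro (⟨h1, h2⟩ | ⟨h1, h2 | h2⟩)
    · exact ⟨h1, Or.inr h2⟩
    · exact ⟨h1, Or.inl h2⟩
    · exact ⟨h1, Or.inl h2.symm⟩
  · rintro ⟨h1, h2 | h2⟩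
    · exact Or.inr ⟨h1, Or.inl h2⟩
    · exact Or.inl ⟨h1, h2⟩

/-- The vertex of `T_2` formed by the last two letters of `px`. -/
def lastTwo (a : A.postCriticalSet × X) : {v : List X // v.length = 2} :=
  ⟨[a.1.1 0, a.2], rfl⟩

theorem ModelEdge.tileGraph_adj {a b : A.postCriticalSet × X} (h : A.ModelEdge a b)
    (hne : a.2 ≠ b.2) : (A.tileGraph 2).Adj (lastTwo a) (lastTwo b) := by
  obtain ⟨t, ht, hpath⟩ := h
  obtain ⟨h1, h2⟩ := LeftPath.actWord (A := A) hpath 2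
  refine (SimpleGraph.fromRel_adj _ _ _).2
    ⟨fun h => hne (List.cons.inj (List.cons.inj (congrArg Subtype.val h)).2).1,
      Or.inl ⟨t 2, h1, ?_⟩⟩
  exact h2.symm ▸ ht

/-- Vertices with the same letter form a clique. Each edge of `T_1` lifts to a model edge by
extending its state to a left-infinite path, so connectedness of `T_1` suffices. -/
theorem augmentedModelGraph_connected (hmin : A.IsMinimal) (hsymm : A.IsSymmetric)
    (hinc : A.HasIncomingArrows) (htile : (A.tileGraph 1).Connected)
    (hP : A.postCriticalSet.Nonempty) [Nonempty X] : A.augmentedModelGraph.Connected := by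
  have hclique : ∀ (p q : A.postCriticalSet) (x : X),
      A.augmentedModelGraph.Reachable (p, x) (q, x) := by
    intro p q x
    by_cases hpq : p = q
    · rw [hpq]
    · have hne : (p, x) ≠ (q, x) := by simpa using hpq
      exact (augmentedModelGraph_adj.2 ⟨hne, Or.inl rfl⟩).reachable
  have key : ∀ a b : {v : List X // v.length = 1}, (A.tileGraph 1).Walk a b →
      ∀ x y, a.1 = [x] → b.1 = [y] → ∀ p q : A.postCriticalSet,
        A.augmentedModelGraph.Reachable (p, x) (q, y) := by
    intro a b w
    induction w with
    | nil =>
      intro x y hx hy p q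
      obtain rfl : x = y := (List.cons.inj (hx.symm.trans hy)).1
      exact hclique p q x
    | @cons a b c hadj _ ih =>
      intro x y hx hy p q
      obtain ⟨x', hx'⟩ := List.length_eq_one_iff.1 b.2
      obtain ⟨hne, s, hs, htriv⟩ := (InvertibleAutomaton.tileGraph_adj hmin hsymm).1 hadj
      rw [hx, hx'] at hs hne
      rw [hx] at htriv
      have hout : A.out s x = x' := (List.cons.inj hs).1
      have hxx' : x ≠ x' := fun h => hne (by rw [h])
      obtain ⟨t, p', q', hpath, h0, -, -⟩ := exists_leftPath hinc s []
      have h0' : t 0 = s := h0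
      have hnt : ¬ A.IsTrivial (t 0) := by
        rw [h0']
        exact fun h => hxx' ((h.out_eq x).symm.trans hout)
      let P' : A.postCriticalSet := ⟨p', hpath.mem_postCriticalSet hnt⟩
      let Q' : A.postCriticalSet := ⟨q', hpath.mem_postCriticalSet_right hmin hsymm hnt⟩
      have hedge : A.ModelEdge (P', x) (Q', x') := by
        have hcons := hpath.cons x
        rw [h0', hout] at hcons
        exact ⟨_, htriv, hcons⟩
      have hadj' : A.augmentedModelGraph.Adj (P', x) (Q', x') :=
        augmentedModelGraph_adj.2 ⟨fun h => hxx' (congrArg Prod.snd h), Or.inr (Or.inl hedge)⟩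
      exact (hclique p P' x).trans (hadj'.reachable.trans (ih x' y hx' hy Q' q))
  have : Nonempty A.postCriticalSet := hP.to_subtype
  refine ⟨fun a b => ?_⟩
  obtain ⟨w⟩ := htile.preconnected ⟨[a.2], rfl⟩ ⟨[b.2], rfl⟩
  exact key _ _ w a.2 b.2 rfl rfl a.1 b.1

theorem tail_mem_postCriticalSet {r : ℕ → X} (hr : r ∈ A.postCriticalSet) :
    (fun i => r (i + 1)) ∈ A.postCriticalSet := by
  obtain ⟨t, ht, q, h⟩ := hr
  exact ⟨fun i => t (i + 1), fun i => ht (i + 1), fun i => q (i + 1), fun i => h (i + 1)⟩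

theorem snoc_tail (r : ℕ → X) : snoc (fun i => r (i + 1)) (r 0) = r := by
  funext i
  cases i <;> rfl

theorem augmentedModelGraph_iso_pathGraph [Finite X] [Nontrivial X] (hmin : A.IsMinimal)
    (hbdd : A.IsBounded) (htile : ∀ n, (A.tileGraph n).Connected) (hinc : A.HasIncomingArrows)
    (hsymm : A.IsSymmetric) (h : ¬ A.HasEnclosedTile) :
    ∃ (n : ℕ) (φ : A.augmentedModelGraph ≃g SimpleGraph.pathGraph (n + 2)),
      ∀ a, A.IsPostCriticalVertex a ↔ φ a = 0 ∨ φ a = Fin.last (n + 1) := by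
  have h2 := encard_postCriticalSet_eq_two hmin hbdd htile hinc hsymm h
  have hfin : A.postCriticalSet.Finite := Set.finite_of_encard_eq_coe (k := 2) h2
  have : Finite A.postCriticalSet := hfin.to_subtype
  obtain ⟨r₁, r₂, hr, hP⟩ := Set.encard_eq_two.1 h2
  have hr₁ : r₁ ∈ A.postCriticalSet := by simp [hP]
  have hr₂ : r₂ ∈ A.postCriticalSet := by simp [hP]
  have hinj : ∀ a b : A.postCriticalSet × X, lastTwo a = lastTwo b → a = b := by
    intro a b hab
    obtain ⟨h1, h2⟩ := List.cons.inj (congrArg Subtype.val hab)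
    exact Prod.ext (Subtype.ext (postCriticalSet_ext hmin hbdd htile hinc hsymm h a.1.2 b.1.2 h1))
      (List.cons.inj h2).1
  have hsame : ∀ v a b : A.postCriticalSet × X, A.augmentedModelGraph.Adj v a →
      A.augmentedModelGraph.Adj v b → v.2 = a.2 → v.2 = b.2 → a = b := by
    rintro ⟨⟨p, hp⟩, x⟩ ⟨⟨q, hq⟩, y⟩ ⟨⟨q', hq'⟩, y'⟩ ha hb hxy hxy'
    obtain rfl : x = y := hxy
    obtain rfl : x = y' := hxy'
    have hne := ha.ne
    have hne' := hb.ne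
    simp only [ne_eq, Prod.mk.injEq, Subtype.mk.injEq, and_true] at hne hne' ⊢
    rw [hP] at hp hq hq'
    rcases hp with rfl | rfl <;> rcases hq with rfl | rfl <;> rcases hq' with rfl | rfl <;>
      simp_all
  have hdiff : ∀ v a : A.postCriticalSet × X, A.augmentedModelGraph.Adj v a → v.2 ≠ a.2 →
      (A.tileGraph 2).Adj (lastTwo v) (lastTwo a) := by
    intro v a ha hne
    rcases (augmentedModelGraph_adj.1 ha).2 with h | h | h
    · exact absurd h hne
    · exact h.tileGraph_adj hne
    · exact (h.tileGraph_adj hne.symm).symm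
  -- In `T_2` one neighbour is used up inside the copy of `T_1` with the same final letter. This
  -- leaves at most one neighbour with another letter, and none at post-critical vertices.
  have hown : ∀ v : A.postCriticalSet × X, ∃ c, (A.tileGraph 2).Adj (lastTwo v) c ∧
      ∀ a : A.postCriticalSet × X, v.2 ≠ a.2 → lastTwo a ≠ c := by
    intro v
    have := vertex_nontrivial (X := X) (le_refl 1)
    obtain ⟨c, hc⟩ := (htile 1).preconnected.exists_adj_of_nontrivial ⟨[v.1.1 0], rfl⟩
    refine ⟨appendVertex c ⟨[v.2], rfl⟩,
      tileGraph_adj_appendVertex hmin hsymm hc ⟨[v.2], rfl⟩, fun a hne hac => hne ?_⟩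
    have h1 := appendVertex_inj (v := ⟨[a.1.1 0], rfl⟩) (z := ⟨[a.2], rfl⟩) hac
    exact (List.cons.inj (congrArg Subtype.val h1.2)).1.symm
  have hconn := augmentedModelGraph_connected hmin hsymm hinc (htile 1) ⟨r₁, hr₁⟩
  have hdeg2 := tileGraph_degree_le_two hmin hbdd htile hsymm h (n := 2)
  have htwo : ∀ v a b : A.postCriticalSet × X, A.augmentedModelGraph.Adj v a →
      A.augmentedModelGraph.Adj v b → v.2 ≠ a.2 → v.2 ≠ b.2 → a = b := by
    intro v a b ha hb hva hvb
    obtain ⟨c, hc, hc'⟩ := hown v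
    rcases hdeg2 _ _ _ _ (hdiff v a ha hva) (hdiff v b hb hvb) hc with h | h | h
    · exact hinj _ _ h
    · exact absurd h (hc' a hva)
    · exact absurd h (hc' b hvb)
  have hend : ∀ v : A.postCriticalSet × X, A.IsPostCriticalVertex v → ∀ a b,
      A.augmentedModelGraph.Adj v a → A.augmentedModelGraph.Adj v b → a = b := by
    intro v hv a b ha hb
    have hvP : lastTwo v ∈ A.postVertices 2 := reverse_pre_mem_postWords hv 2
    obtain ⟨c, hc, hc'⟩ := hown v
    have hvs : ∀ a, A.augmentedModelGraph.Adj v a → v.2 = a.2 := by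
      intro a ha
      by_contra hne
      exact hc' a hne (postVertices_degree_le_one hmin hbdd htile hsymm h _ hvP _ _
        (hdiff v a ha hne) hc)
    exact hsame v a b ha hb (hvs a ha) (hvs b hb)
  -- The post-critical vertices arise by splitting off the last letter of each of the two
  -- post-critical sequences.
  let e₁ : A.postCriticalSet × X := (⟨_, tail_mem_postCriticalSet hr₁⟩, r₁ 0)
  let e₂ : A.postCriticalSet × X := (⟨_, tail_mem_postCriticalSet hr₂⟩, r₂ 0)
  have he₁ : snoc e₁.1.1 e₁.2 = r₁ := snoc_tail r₁
  have he₂ : snoc e₂.1.1 e₂.2 = r₂ := snoc_tail r₂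
  have hpost : ∀ v, A.IsPostCriticalVertex v ↔ v = e₁ ∨ v = e₂ := by
    have hcancel : ∀ v e : A.postCriticalSet × X, snoc v.1.1 v.2 = snoc e.1.1 e.2 → v = e := by
      intro v e h
      obtain ⟨h1, h2⟩ := snoc_injective h
      exact Prod.ext (Subtype.ext h1) h2
    intro v
    constructor
    · intro hv
      have hv' : snoc v.1.1 v.2 ∈ ({r₁, r₂} : Set (ℕ → X)) := hP.le hv
      rcases hv' with hv | hv
      · exact Or.inl (hcancel _ _ (hv.trans he₁.symm))
      · exact Or.inr (hcancel _ _ (hv.trans he₂.symm))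
    · rintro (rfl | rfl)
      · exact he₁.symm.subst (motive := (· ∈ A.postCriticalSet)) hr₁
      · exact he₂.symm.subst (motive := (· ∈ A.postCriticalSet)) hr₂
  have hne : e₁ ≠ e₂ := fun h => hr (by rw [← he₁, ← he₂, h])
  -- Of three neighbours, two agree on whether they share the letter of `v`, and there is at most
  -- one of each kind.
  obtain ⟨n, φ, h0, hlast⟩ := hconn.exists_iso_pathGraph (fun v a b c ha hb hc => by
      by_cases h1 : v.2 = a.2 <;> by_cases h2 : v.2 = b.2 <;> by_cases h3 : v.2 = c.2
      · exact Or.inl (hsame v a b ha hb h1 h2)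
      · exact Or.inl (hsame v a b ha hb h1 h2)
      · exact Or.inr (Or.inl (hsame v a c ha hc h1 h3))
      · exact Or.inr (Or.inr (htwo v b c hb hc h2 h3))
      · exact Or.inr (Or.inr (hsame v b c hb hc h2 h3))
      · exact Or.inr (Or.inl (htwo v a c ha hc h1 h3))
      · exact Or.inl (htwo v a b ha hb h1 h2)
      · exact Or.inl (htwo v a b ha hb h1 h2))
    hne (hend e₁ ((hpost e₁).2 (Or.inl rfl))) (hend e₂ ((hpost e₂).2 (Or.inr rfl)))
  refine ⟨n, φ, fun v => (hpost v).trans ?_⟩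
  rw [← h0, ← hlast, φ.injective.eq_iff, φ.injective.eq_iff]

end InvertibleAutomaton

theorem mainTheorem8 {S X : Type*} [Finite S] [Fintype X] [Nontrivial X]
    [MeasurableSpace X] [DiscreteMeasurableSpace X]
    (A : InvertibleAutomaton S X)
    (hmin : A.IsMinimal) (hbdd : A.IsBounded)
    (htile : ∀ n, (A.tileGraph n).Connected)
    (hinc : A.HasIncomingArrows) (hsymm : A.IsSymmetric) :
    ((∀ᵐ w ∂(uniformBernoulli X), (A.schreierGraph w).numEnds = 2) ↔
      ∀ᵐ w ∂(uniformBernoulli X), (A.orbitalTileGraph w).numEnds = 2) ∧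
    ((∀ᵐ w ∂(uniformBernoulli X), (A.schreierGraph w).numEnds = 2) →
      A.postCriticalSet.encard = 2 ∧
      ∃ (n : ℕ) (φ : A.augmentedModelGraph ≃g SimpleGraph.pathGraph (n + 2)),
        ∀ a, A.IsPostCriticalVertex a ↔ φ a = 0 ∨ φ a = Fin.last (n + 1)) ∧
    (3 ≤ A.postCriticalSet.encard →
      ∀ᵐ w ∂(uniformBernoulli X),
        (A.schreierGraph w).numEnds = 1 ∧ (A.orbitalTileGraph w).numEnds = 1) := by
  have heq : ∀ᵐ w ∂uniformBernoulli X,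
      (A.orbitalTileGraph w).numEnds = (A.schreierGraph w).numEnds :=
    (InvertibleAutomaton.ae_isRegularSeq hbdd).mono fun w hw => hw.numEnds_orbitalTileGraph hsymm
  refine ⟨Filter.eventually_congr (heq.mono fun w hw => by rw [hw]), fun h2 => ?_, fun h3 => ?_⟩
  · have h : ¬ A.HasEnclosedTile := by
      intro h
      obtain ⟨w, hw1, hw2⟩ :=
        ((h.ae_numEnds_eq_one hmin hbdd htile hinc hsymm).and h2).exists
      exact absurd (hw1.symm.trans hw2) (by decide)
    exact ⟨InvertibleAutomaton.encard_postCriticalSet_eq_two hmin hbdd htile hinc hsymm h,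
      InvertibleAutomaton.augmentedModelGraph_iso_pathGraph hmin hbdd htile hinc hsymm h⟩
  · have h : A.HasEnclosedTile := by
      by_contra h
      rw [InvertibleAutomaton.encard_postCriticalSet_eq_two hmin hbdd htile hinc hsymm h] at h3
      exact absurd h3 (by decide)
    filter_upwards [heq, h.ae_numEnds_eq_one hmin hbdd htile hinc hsymm] with w hw h1
    exact ⟨h1, hw.trans h1⟩
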